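/- Let $K$ be a division ring. A $K$-ring is a ring $A$ with a ring homomorphism $K\to A$; it is finite-dimensional if it is so as a left $K$-module. Let $Q$ be a finite quiver with head and tail functions $h,t\colon Q_1\to Q_0$, where $ba$ is a path if $t(b)=h(a)$. Let $Z$ be a set of paths of length $2$ in $Q$ such that $(Q,Z)$ is locally gentle: every vertex is the head of at most two arrows and the tail of at most two arrows, and for every arrow $b$ there is at most one arrow $c$ with $cb$ a path in $Z$, at most one arrow $c$ with $cb$ a path not in $Z$, at most one arrow $a$ with $ba$ a path in $Z$, and at most one arrow $a$ with $ba$ a path not in $Z$. Let $\sigma_a\in\operatorname{Aut}(K)$ for each $a\in Q_1$. The semilinear path ring $K_{\sigma}Q$ is the $K$-ring generated by the trivial paths $e_v$ ($v\in Q_0$) and the arrows $a\in Q_1$, subject to $\sum_v e_v=1$, $e_ve_v=e_v$, $e_ue_v=0$ for $u\neq v$, $e_v\lambda=\lambda e_v$, $e_{h(a)}a=a=ae_{t(a)}$ and $a\lambda=\sigma_a(\lambda)a$ for $\lambda\in K$. Let $v$ be a relational vertex, that is, $t(b)=v=h(a)$ for some $ba\in Z$. The levee of $(Q,Z)$ at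 $v$ is the pair obtained as follows. Replace $v$ by two new vertices $v(\sharp),v(\flat)$ and keep all arrows. Let $b$ start at $v(\sharp)$, and let the other arrow $d\neq b$ with tail $v$ (if there is one) start at $v(\flat)$. Let $a$ end at $v(\flat)$, and let the other arrow $c\neq a$ with head $v$ (if there is one) end at $v(\sharp)$. Leave all other heads and tails unchanged, and remove from $Z$ the paths $mn$ with $t(m)=v=h(n)$. A Zembyk excision of $(Q,Z)$ is a quiver obtained by taking successive levees at relational vertices until no relation is left. A finite-dimensional $K$-ring $\Lambda$ is nodal, connected with a $K$-ring $\Gamma$, if $\Gamma$ is finite-dimensional and (left and right) hereditary, and there is an injective homomorphism $\Lambda\to\Gamma$ of $K$-rings such that, when $\Lambda$ is regarded as a subring of $\Gamma$, one has $\operatorname{rad}(\Lambda)=\operatorname{rad}(\Gamma)$ (Jacobson radicals), and for every simple left $\Lambda$-module $U$ the left $\Lambda$-module $\Gamma\otimes_\Lambda U$ has length at most $2$. Theorem. Suppose that $\Lambda=K_{\sigma}Q/\langle Z\rangle$ is finite-dimensional over $K$. Then $\Lambda$ is nodal. More precisely, a Zembyk excision of $(Q,Z)$ exists, and every Zembyk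 excision $Q'$ of $(Q,Z)$, whatever choices are made in its construction, is acyclic, and $\Lambda$ is nodal, connected with $\Gamma=K_{\sigma'}Q'$, where $\sigma'$ assigns to each arrow of $Q'$ the automorphism of the corresponding arrow of $Q$. -/

import Mathlib

open scoped TensorProduct

universe u v w x y

/-! ### Finite quivers, quadratic zero-relations, (locally) gentle pairs -/

/-- A quiver with finitely many vertices and with arrow set `E`; the arrow `a` goes from `tail a` to
`head a`. Paths are written from right to left: `b a` is a path if `tail b = head a`. -/
structure FinQuiver (E : Type v) where
  Vertex : Type w
  finite_vertex : Finite Vertex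
  head : E → Vertex
  tail : E → Vertex

/-- A quiver together with a set of paths of length two (quadratic zero-relations).
The pair `(b, a)` in `rel` stands for the path `b a`. -/
structure BoundQuiver (E : Type v) extends FinQuiver.{v, w} E where
  rel : Set (E × E)
  rel_comp : ∀ b a : E, (b, a) ∈ rel → tail b = head a

/-- There is no oriented cycle of positive length. -/
def FinQuiver.Acyclic {E : Type v} (Q : FinQuiver.{v, w} E) : Prop :=
  ∀ s : Q.Vertex, ¬ Relation.TransGen (fun s t => ∃ a : E, Q.tail a = s ∧ Q.head a = t) s s

namespace BoundQuiver

variable {E : Type v}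

/-- `(Q, Z)` is locally gentle. -/
structure LocallyGentle (Q : BoundQuiver.{v, w} E) : Prop where
  head_le_two : ∀ s : Q.Vertex, {a : E | Q.head a = s}.encard ≤ 2
  tail_le_two : ∀ s : Q.Vertex, {a : E | Q.tail a = s}.encard ≤ 2
  left_inadmissible : ∀ b : E, {c : E | Q.tail c = Q.head b ∧ (c, b) ∈ Q.rel}.Subsingleton
  left_admissible : ∀ b : E, {c : E | Q.tail c = Q.head b ∧ (c, b) ∉ Q.rel}.Subsingleton
  right_inadmissible : ∀ b : E, {a : E | Q.tail b = Q.head a ∧ (b, a) ∈ Q.rel}.Subsingleton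
  right_admissible : ∀ b : E, {a : E | Q.tail b = Q.head a ∧ (b, a) ∉ Q.rel}.Subsingleton

open Classical in
/-- The levee of `(Q, Z)` at the relational vertex `s = tail b = head a`, where `b a ∈ Z`.
The vertex `s` is replaced by two vertices `s(♯) = Sum.inr true` and `s(♭) = Sum.inr false`. Then
`b` starts at `s(♯)`, and the other arrow `c ≠ a` with head `s` (if any) ends at `s(♯)`;
`a` ends at `s(♭)`, and the other arrow `d ≠ b` with tail `s` (if any) starts at `s(♭)`.
The arrows of the new quiver are identified with those of `Q`. The relations of the levee are those
relations of `Q` that do not pass through `s`. (Interchanging the roles of the two possible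
relations `b a`, `d c` at `s` interchanges the labels `♯` and `♭`.) -/
noncomputable def levee (Q : BoundQuiver.{v, w} E) (s : Q.Vertex) (b a : E) :
    BoundQuiver.{v, w} E where
  Vertex := {t : Q.Vertex // t ≠ s} ⊕ Bool
  finite_vertex := by
    have := Q.finite_vertex
    infer_instance
  head := fun f =>
    if h : Q.head f = s then (if f = a then Sum.inr false else Sum.inr true)
    else Sum.inl ⟨Q.head f, h⟩
  tail := fun f =>
    if h : Q.tail f = s then (if f = b then Sum.inr true else Sum.inr false)
    else Sum.inl ⟨Q.tail f, h⟩
  rel := {p | p ∈ Q.rel ∧ Q.tail p.1 ≠ s ∧ Q.head p.2 ≠ s}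
  rel_comp := by
    rintro m n ⟨hr, hm, hn⟩
    have hm' : Q.tail m ≠ s := hm
    have hn' : Q.head n ≠ s := hn
    rw [dif_neg hm', dif_neg hn']
    exact congrArg Sum.inl (Subtype.ext (Q.rel_comp m n hr))

/-- `Q'` is a levee of `Q` at some relational vertex, i.e. a vertex `s = tail b = head a` through
which some relation `b a ∈ Z` passes. -/
def IsLevee (Q Q' : BoundQuiver.{v, w} E) : Prop :=
  ∃ (s : Q.Vertex) (b a : E), (b, a) ∈ Q.rel ∧ Q.tail b = s ∧ Q.head a = s ∧ Q' = Q.levee s b a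

/-- `Q'` is an output of the Zembyk excision algorithm applied to `(Q, Z)`: choose relational
vertices and take successive levees until no relation is left. -/
def IsExcision (Q : BoundQuiver.{v, w} E) (Q' : FinQuiver.{v, w} E) : Prop :=
  ∃ P : BoundQuiver.{v, w} E,
    Relation.ReflTransGen IsLevee Q P ∧ P.rel = ∅ ∧ Q' = P.toFinQuiver

end BoundQuiver

/-! ### Semilinear path rings

A `K`-ring is a ring `A` together with a ring homomorphism `K →+* A`. -/

/-- The generators of the semilinear path ring, including the elements of `K`. -/
inductive PathGen (K : Type u) (V : Type w) (E : Type v) : Type (max u v w)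
  | scalar (k : K) : PathGen K V E
  | vertex (s : V) : PathGen K V E
  | arrow (a : E) : PathGen K V E

namespace FinQuiver

variable {E : Type v} {K : Type u} [DivisionRing K]

/-- The generator attached to an element of `K` (in the free ring). -/
noncomputable def gk (Q : FinQuiver.{v, w} E) (k : K) : FreeAlgebra ℤ (PathGen K Q.Vertex E) :=
  FreeAlgebra.ι ℤ (PathGen.scalar k)

/-- The generator attached to a trivial path (in the free ring). -/
noncomputable def ge (K : Type u) (Q : FinQuiver.{v, w} E) (s : Q.Vertex) :
    FreeAlgebra ℤ (PathGen K Q.Vertex E) :=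
  FreeAlgebra.ι ℤ (PathGen.vertex s)

/-- The generator attached to an arrow (in the free ring). -/
noncomputable def ga (K : Type u) (Q : FinQuiver.{v, w} E) (a : E) :
    FreeAlgebra ℤ (PathGen K Q.Vertex E) :=
  FreeAlgebra.ι ℤ (PathGen.arrow a)

/-- The defining relations of the semilinear path ring. The first three say that `K` maps to it by
a ring homomorphism. -/
inductive PathRel (Q : FinQuiver.{v, w} E) (σ : E → RingAut K) :
    FreeAlgebra ℤ (PathGen K Q.Vertex E) → FreeAlgebra ℤ (PathGen K Q.Vertex E) → Prop
  | scalar_one : PathRel Q σ (Q.gk 1) 1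
  | scalar_add (k l : K) : PathRel Q σ (Q.gk (k + l)) (Q.gk k + Q.gk l)
  | scalar_mul (k l : K) : PathRel Q σ (Q.gk (k * l)) (Q.gk k * Q.gk l)
  | vertex_sum : PathRel Q σ (∑ᶠ s : Q.Vertex, ge K Q s) 1
  | vertex_idem (s : Q.Vertex) : PathRel Q σ (ge K Q s * ge K Q s) (ge K Q s)
  | vertex_orth (s t : Q.Vertex) : s ≠ t → PathRel Q σ (ge K Q s * ge K Q t) 0
  | vertex_scalar (s : Q.Vertex) (k : K) : PathRel Q σ (ge K Q s * Q.gk k) (Q.gk k * ge K Q s)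
  | head_arrow (a : E) : PathRel Q σ (ge K Q (Q.head a) * ga K Q a) (ga K Q a)
  | arrow_tail (a : E) : PathRel Q σ (ga K Q a * ge K Q (Q.tail a)) (ga K Q a)
  | arrow_scalar (a : E) (k : K) : PathRel Q σ (ga K Q a * Q.gk k) (Q.gk (σ a k) * ga K Q a)

/-- The semilinear path ring `K_σ Q`. -/
abbrev PathRing (Q : FinQuiver.{v, w} E) (σ : E → RingAut K) : Type (max u v w) :=
  RingQuot (PathRel Q σ)

/-- The structure map of the `K`-ring `K_σ Q`. -/
noncomputable def scalarHom (Q : FinQuiver.{v, w} E) (σ : E → RingAut K) :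
    K →+* PathRing Q σ where
  toFun k := RingQuot.mkRingHom (PathRel Q σ) (Q.gk k)
  map_one' := by
    rw [RingQuot.mkRingHom_rel PathRel.scalar_one, map_one]
  map_mul' k l := by
    rw [RingQuot.mkRingHom_rel (PathRel.scalar_mul k l), map_mul]
  map_zero' := by
    have h := RingQuot.mkRingHom_rel (PathRel.scalar_add (Q := Q) (σ := σ) 0 0)
    rw [add_zero, map_add] at h
    exact left_eq_add.mp h
  map_add' k l := by
    rw [RingQuot.mkRingHom_rel (PathRel.scalar_add k l), map_add]

/-- The element of `K_σ Q` given by an arrow. -/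
noncomputable def arrow (Q : FinQuiver.{v, w} E) (σ : E → RingAut K) (a : E) : PathRing Q σ :=
  RingQuot.mkRingHom (PathRel Q σ) (ga K Q a)

end FinQuiver

namespace BoundQuiver

variable {E : Type v} {K : Type u} [DivisionRing K]

/-- The two-sided ideal `⟨Z⟩` of `K_σ Q`. -/
noncomputable def relIdeal (Q : BoundQuiver.{v, w} E) (σ : E → RingAut K) :
    TwoSidedIdeal (Q.toFinQuiver.PathRing σ) :=
  TwoSidedIdeal.span
    {r | ∃ b a : E, (b, a) ∈ Q.rel ∧ r = Q.toFinQuiver.arrow σ b * Q.toFinQuiver.arrow σ a}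

/-- The ring `K_σ Q / ⟨Z⟩`. -/
abbrev QuotRing (Q : BoundQuiver.{v, w} E) (σ : E → RingAut K) : Type (max u v w) :=
  (Q.relIdeal σ).ringCon.Quotient

/-- The structure map of the `K`-ring `K_σ Q / ⟨Z⟩`. -/
noncomputable def quotScalarHom (Q : BoundQuiver.{v, w} E) (σ : E → RingAut K) :
    K →+* Q.QuotRing σ :=
  (Q.relIdeal σ).ringCon.mk'.comp (Q.toFinQuiver.scalarHom σ)

end BoundQuiver

/-! ### Nodal `K`-rings -/

/-- A `K`-ring is finite-dimensional if it is so as a left `K`-module. -/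
def FiniteDimKRing {K : Type u} {A : Type w} [DivisionRing K] [Ring A] (i : K →+* A) : Prop :=
  letI : Module K A := i.toModule
  Module.Finite K A

/-- Every left ideal and every right ideal is projective. -/
def IsHereditaryRing (A : Type w) [Ring A] : Prop :=
  (∀ I : Submodule A A, Module.Projective A I) ∧
    (∀ I : Submodule Aᵐᵒᵖ A, Module.Projective Aᵐᵒᵖ I)

section BaseChange

variable {L : Type w} {G : Type y} [Ring L] [Ring G]

/-- The subgroup of `G ⊗_ℤ U` generated by all `g f(l) ⊗ u - g ⊗ l u`; it is a `G`-submodule. -/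
def balancedSubmodule (f : L →+* G) (U : Type x) [AddCommGroup U] [Module L U] :
    Submodule G (G ⊗[ℤ] U) :=
  Submodule.span G {r | ∃ (g : G) (l : L) (n : U), r = (g * f l) ⊗ₜ[ℤ] n - g ⊗ₜ[ℤ] (l • n)}

/-- The left `G`-module `G ⊗_L U`, for a homomorphism `f : L → G` of possibly noncommutative rings
and a left `L`-module `U`. -/
abbrev BaseChange (f : L →+* G) (U : Type x) [AddCommGroup U] [Module L U] : Type (max x y) :=
  (G ⊗[ℤ] U) ⧸ balancedSubmodule f U

/-- The length of `G ⊗_L U` as a left `L`-module. -/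
noncomputable def baseChangeLength (f : L →+* G) (U : Type x) [AddCommGroup U] [Module L U] :
    ℕ∞ :=
  letI : Module L (BaseChange f U) := Module.compHom (BaseChange f U) f
  Module.length L (BaseChange f U)

end BaseChange

/-- `f` exhibits the `K`-ring `(L, i)` as a nodal `K`-ring, connected with the `K`-ring `(G, j)`. -/
structure IsNodalEmbedding {K : Type u} {L : Type w} {G : Type y} [DivisionRing K] [Ring L] [Ring G]
    (i : K →+* L) (j : K →+* G) (f : L →+* G) : Prop where
  finite_dim_sub : FiniteDimKRing i
  finite_dim : FiniteDimKRing j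
  hereditary : IsHereditaryRing G
  injective : Function.Injective f
  comp_eq : f.comp i = j
  radical_eq : f '' (Ring.jacobson L : Set L) = (Ring.jacobson G : Set G)
  length_le : ∀ (U : Type x) [AddCommGroup U] [Module L U], IsSimpleModule L U →
    baseChangeLength f U ≤ 2

/-- The `K`-ring `(L, i)` is nodal, connected with the `K`-ring `(G, j)`. -/
def IsNodalConnectedWith {K : Type u} {L : Type w} {G : Type y} [DivisionRing K] [Ring L] [Ring G]
    (i : K →+* L) (j : K →+* G) : Prop :=
  ∃ f : L →+* G, IsNodalEmbedding.{u, w, x, y} i j f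

/-- The `K`-ring `(L, i)` is nodal. -/
def IsNodal {K : Type u} {L : Type w} [DivisionRing K] [Ring L] (i : K →+* L) : Prop :=
  ∃ (G : Type w) (_ : Ring G) (j : K →+* G), IsNodalConnectedWith.{u, w, x, w} i j

/-! Let `ba` be a relation through a vertex `v`. The gentle conditions force the relations through
`v` to form a matching: `dc` is a relation iff (`d = b` ↔ `c = a`) (`LocallyGentle.mem_rel_iff`).
The levee splits `v` so that `d` and `c` still meet exactly when `dc` was not a relation
(`levee_tail_eq_head_iff`). So a levee preserves local gentleness and the admissible paths of length
two, and lowers the number of relations. The two new vertices carry no relation, so no vertex is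
split twice. An excision is therefore a quiver `P` without relations whose paths are the admissible
paths of `Q`, with a surjection `π` on vertices whose fibres have at most two elements
(`IsSplitting`).

The embedding sends a vertex to the sum of its fibre and an arrow to itself. The quotient is spanned
by vertices and admissible paths (`comb_surjective`), while in the path ring of `P` vertices and
paths are left independent, as its action on a space of formal paths shows (`comb_injective`). In
these coordinates the embedding is pullback along `π` on vertices and the identity on paths, so it
is injective. It follows that admissible paths are independent in the quotient; finite dimension
then bounds their length, which makes `P` acyclic and its path ring finite-dimensional. Both
radicals are spanned by the nontrivial paths, hence agree.

For heredity, left multiplication by the arrows is jointly injective on the path ring of `P`, hence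
on every left ideal, and a Nakayama argument makes such modules projective
(`IsArrowSystem.projective`); right ideals are treated over the opposite ring. Finally, a simple
module `U` is concentrated at one vertex `s`. Elements of the common radical can be moved across the
tensor sign and kill `U`, so the base change is spanned by the `e_t ⊗ U` with `π t = s` and is a
quotient of `U × U`. -/

/-! ### The universal property of the semilinear path ring -/

namespace FinQuiver

variable {E : Type v} {K : Type u} [DivisionRing K]

/-- The element of `K_σ Q` given by a trivial path. -/
noncomputable def vert (Q : FinQuiver.{v, w} E) (σ : E → RingAut K) (s : Q.Vertex) :
    PathRing Q σ :=
  RingQuot.mkRingHom (PathRel Q σ) (ge K Q s)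

/-- Elements `e s` and `α a` of a `K`-ring which satisfy the defining relations of `K_σ Q`. -/
structure IsPathFamily (Q : FinQuiver.{v, w} E) (σ : E → RingAut K) {A : Type*} [Ring A]
    (i : K →+* A) (e : Q.Vertex → A) (α : E → A) : Prop where
  vertex_sum : ∑ᶠ s, e s = 1
  vertex_idem (s : Q.Vertex) : e s * e s = e s
  vertex_orth (s t : Q.Vertex) : s ≠ t → e s * e t = 0
  vertex_scalar (s : Q.Vertex) (k : K) : e s * i k = i k * e s
  head_arrow (a : E) : e (Q.head a) * α a = α a
  arrow_tail (a : E) : α a * e (Q.tail a) = α a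
  arrow_scalar (a : E) (k : K) : α a * i k = i (σ a k) * α a

/-- A `K`-ring is generated, over the image of `K`, by the elements `e s` and `α a`. -/
def Generates {V A : Type*} [Ring A] (i : K →+* A) (e : V → A) (α : E → A) : Prop :=
  ∀ S : Subring A, (∀ k, i k ∈ S) → (∀ s, e s ∈ S) → (∀ a, α a ∈ S) → ∀ r, r ∈ S

theorem isPathFamily (Q : FinQuiver.{v, w} E) (σ : E → RingAut K) :
    IsPathFamily Q σ (Q.scalarHom σ) (Q.vert σ) (Q.arrow σ) where
  vertex_sum := by
    have := Q.finite_vertex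
    have h := RingQuot.mkRingHom_rel (PathRel.vertex_sum (Q := Q) (σ := σ))
    rw [map_one] at h
    rw [← h]
    exact ((RingQuot.mkRingHom (PathRel Q σ)).toAddMonoidHom.map_finsum
      (Set.toFinite _)).symm
  vertex_idem s := (map_mul _ _ _).symm.trans (RingQuot.mkRingHom_rel (PathRel.vertex_idem s))
  vertex_orth s t h := (map_mul _ _ _).symm.trans
    ((RingQuot.mkRingHom_rel (PathRel.vertex_orth s t h)).trans (map_zero _))
  vertex_scalar s k := (map_mul _ _ _).symm.trans
    ((RingQuot.mkRingHom_rel (PathRel.vertex_scalar s k)).trans (map_mul _ _ _))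
  head_arrow a := (map_mul _ _ _).symm.trans (RingQuot.mkRingHom_rel (PathRel.head_arrow a))
  arrow_tail a := (map_mul _ _ _).symm.trans (RingQuot.mkRingHom_rel (PathRel.arrow_tail a))
  arrow_scalar a k := (map_mul _ _ _).symm.trans
    ((RingQuot.mkRingHom_rel (PathRel.arrow_scalar a k)).trans (map_mul _ _ _))

/-- The form with subrings lets a property of all elements be checked on generators, once it is
membership in a centralizer or a stabilizer. -/
theorem generates (Q : FinQuiver.{v, w} E) (σ : E → RingAut K) :
    Generates (Q.scalarHom σ) (Q.vert σ) (Q.arrow σ) := by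
  intro S hk he ha r
  obtain ⟨x, rfl⟩ := RingQuot.mkRingHom_surjective _ r
  induction x using FreeAlgebra.induction with
  | grade0 n =>
    rw [eq_intCast, map_intCast]
    exact intCast_mem S n
  | grade1 g =>
    cases g with
    | scalar k => exact hk k
    | vertex s => exact he s
    | arrow a => exact ha a
  | mul x y hx hy => rw [map_mul]; exact mul_mem hx hy
  | add x y hx hy => rw [map_add]; exact add_mem hx hy

theorem Generates.map {V A B : Type*} [Ring A] [Ring B] {i : K →+* A} {e : V → A} {α : E → A}
    (h : Generates i e α) (g : A →+* B) (hg : Function.Surjective g) :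
    Generates (g.comp i) (fun s => g (e s)) (fun a => g (α a)) := by
  intro S hk he ha r
  obtain ⟨x, rfl⟩ := hg r
  exact h (S.comap g) hk he ha x

namespace IsPathFamily

variable {Q : FinQuiver.{v, w} E} {σ : E → RingAut K} {A : Type*} [Ring A]
  {i : K →+* A} {e : Q.Vertex → A} {α : E → A}

theorem map {B : Type*} [Ring B] (h : IsPathFamily Q σ i e α) (g : A →+* B) :
    IsPathFamily Q σ (g.comp i) (fun s => g (e s)) (fun a => g (α a)) where
  vertex_sum := by
    have := Q.finite_vertex
    rw [← map_one g, ← h.vertex_sum]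
    exact (g.toAddMonoidHom.map_finsum (Set.toFinite _)).symm
  vertex_idem s := by rw [← map_mul, h.vertex_idem]
  vertex_orth s t hst := by rw [← map_mul, h.vertex_orth s t hst, map_zero]
  vertex_scalar s k := by simp only [RingHom.comp_apply, ← map_mul, h.vertex_scalar]
  head_arrow a := by rw [← map_mul, h.head_arrow]
  arrow_tail a := by rw [← map_mul, h.arrow_tail]
  arrow_scalar a k := by simp only [RingHom.comp_apply, ← map_mul, h.arrow_scalar]

/-- The assignment of the generators of `K_σ Q`. -/
def genMap (i : K →+* A) (e : Q.Vertex → A) (α : E → A) : PathGen K Q.Vertex E → A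
  | .scalar k => i k
  | .vertex s => e s
  | .arrow a => α a

/-- The ring homomorphism from `K_σ Q` given by its universal property. -/
noncomputable def lift (h : IsPathFamily Q σ i e α) : PathRing Q σ →+* A :=
  RingQuot.lift ⟨(FreeAlgebra.lift ℤ (genMap i e α)).toRingHom, by
    have hk (k : K) : (FreeAlgebra.lift ℤ (genMap i e α)).toRingHom (Q.gk k) = i k :=
      FreeAlgebra.lift_ι_apply _ _
    have he (s : Q.Vertex) : (FreeAlgebra.lift ℤ (genMap i e α)).toRingHom (ge K Q s) = e s :=
      FreeAlgebra.lift_ι_apply _ _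
    have ha (a : E) : (FreeAlgebra.lift ℤ (genMap i e α)).toRingHom (ga K Q a) = α a :=
      FreeAlgebra.lift_ι_apply _ _
    intro x y hxy
    cases hxy with
    | scalar_one => rw [hk, map_one, map_one]
    | scalar_add k l => simp only [hk, map_add]
    | scalar_mul k l => simp only [hk, map_mul]
    | vertex_sum =>
      have := Q.finite_vertex
      rw [map_one, ← h.vertex_sum]
      refine ((FreeAlgebra.lift ℤ (genMap i e α)).toRingHom.toAddMonoidHom.map_finsum
        (Set.toFinite _)).trans ?_
      exact finsum_congr he
    | vertex_idem s => simp only [map_mul, he, h.vertex_idem]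
    | vertex_orth s t hst => simp only [map_mul, he, h.vertex_orth s t hst, map_zero]
    | vertex_scalar s k => simp only [map_mul, he, hk, h.vertex_scalar]
    | head_arrow a => simp only [map_mul, he, ha, h.head_arrow]
    | arrow_tail a => simp only [map_mul, he, ha, h.arrow_tail]
    | arrow_scalar a k => simp only [map_mul, hk, ha, h.arrow_scalar]⟩

theorem lift_scalar (h : IsPathFamily Q σ i e α) (k : K) : h.lift (Q.scalarHom σ k) = i k :=
  (RingQuot.lift_mkRingHom_apply _ _ _).trans (FreeAlgebra.lift_ι_apply _ _)

theorem lift_vert (h : IsPathFamily Q σ i e α) (s : Q.Vertex) : h.lift (Q.vert σ s) = e s :=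
  (RingQuot.lift_mkRingHom_apply _ _ _).trans (FreeAlgebra.lift_ι_apply _ _)

theorem lift_arrow (h : IsPathFamily Q σ i e α) (a : E) : h.lift (Q.arrow σ a) = α a :=
  (RingQuot.lift_mkRingHom_apply _ _ _).trans (FreeAlgebra.lift_ι_apply _ _)

theorem sum_vertex [Fintype Q.Vertex] (h : IsPathFamily Q σ i e α) : ∑ s, e s = 1 := by
  rw [← h.vertex_sum, finsum_eq_sum_of_fintype]

open Classical in
theorem vertex_mul_vertex (h : IsPathFamily Q σ i e α) (s t : Q.Vertex) :
    e s * e t = if s = t then e s else 0 := by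
  split_ifs with hst
  · subst hst; exact h.vertex_idem s
  · exact h.vertex_orth s t hst

open Classical in
theorem vertex_mul_arrow (h : IsPathFamily Q σ i e α) (s : Q.Vertex) (a : E) :
    e s * α a = if s = Q.head a then α a else 0 := by
  rw [← h.head_arrow a, ← mul_assoc, h.vertex_mul_vertex]
  split_ifs with hs
  · rw [hs]
  · rw [zero_mul]

open Classical in
theorem arrow_mul_vertex (h : IsPathFamily Q σ i e α) (s : Q.Vertex) (a : E) :
    α a * e s = if s = Q.tail a then α a else 0 := by
  rw [← h.arrow_tail a, mul_assoc, h.vertex_mul_vertex]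
  split_ifs with h1 h2 h2
  · rfl
  · exact absurd h1.symm h2
  · exact absurd h2.symm h1
  · rw [mul_zero]

theorem arrow_mul_arrow_eq_zero (h : IsPathFamily Q σ i e α) {b a : E}
    (hba : Q.tail b ≠ Q.head a) : α b * α a = 0 := by
  rw [← h.arrow_tail b, ← h.head_arrow a, mul_assoc, ← mul_assoc (e _), h.vertex_orth _ _ hba,
    zero_mul, mul_zero]

end IsPathFamily

end FinQuiver

/-! ### Paths and the radical -/

namespace FinQuiver

variable {E : Type v} {K : Type u} [DivisionRing K]

/-- The product of a list of arrows. -/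
def pathElt {A : Type*} [Ring A] (α : E → A) (l : List E) : A := (l.map α).prod

section pathElt

variable {A : Type*} [Ring A] {α : E → A}

@[simp] theorem pathElt_nil : pathElt α [] = 1 := rfl

@[simp] theorem pathElt_cons (a : E) (l : List E) :
    pathElt α (a :: l) = α a * pathElt α l := List.prod_cons

theorem pathElt_append (l m : List E) : pathElt α (l ++ m) = pathElt α l * pathElt α m := by
  simp [pathElt]

theorem map_pathElt {B : Type*} [Ring B] (f : A →+* B) (l : List E) :
    f (pathElt α l) = pathElt (fun a => f (α a)) l := by
  simp [pathElt, map_list_prod, Function.comp_def]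

theorem pathElt_eq_zero_of_not_isChain {C : E → E → Prop}
    (hC : ∀ b a, ¬ C b a → α b * α a = 0) {l : List E} (hl : ¬ l.IsChain C) :
    pathElt α l = 0 := by
  induction l with
  | nil => exact absurd List.IsChain.nil hl
  | cons b l ih =>
    cases l with
    | nil => exact absurd (List.IsChain.singleton b) hl
    | cons a l =>
      by_cases hba : C b a
      · rw [pathElt_cons, ih, mul_zero]
        exact fun h => hl (List.isChain_cons_cons.mpr ⟨hba, h⟩)
      · rw [pathElt_cons, pathElt_cons, ← mul_assoc, hC b a hba, zero_mul]

end pathElt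

/-- The nonempty lists of arrows in which neighbours are related by `C`. -/
abbrev ChainList (C : E → E → Prop) : Type v := {l : List E // l ≠ [] ∧ l.IsChain C}

/-- The left `K`-linear combinations of vertices and paths. -/
noncomputable def comb {V A : Type*} [Fintype V] [Ring A] (C : E → E → Prop) (i : K →+* A)
    (e : V → A) (α : E → A) : (V → K) × (ChainList C →₀ K) →+ A :=
  (∑ s, (AddMonoidHom.mulRight (e s)).comp
    (i.toAddMonoidHom.comp (Pi.evalAddMonoidHom (fun _ => K) s))).coprod
  (Finsupp.liftAddHom fun l => (AddMonoidHom.mulRight (pathElt α l.1)).comp i.toAddMonoidHom)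

theorem comb_apply {V A : Type*} [Fintype V] [Ring A] (C : E → E → Prop) (i : K →+* A)
    (e : V → A) (α : E → A) (c : V → K) (d : ChainList C →₀ K) :
    comb C i e α (c, d) = ∑ s, i (c s) * e s + d.sum fun l k => i k * pathElt α l.1 := by
  simp only [comb, AddMonoidHom.coprod_apply, AddMonoidHom.finsetSum_apply,
    Finsupp.liftAddHom_apply]
  rfl

theorem map_comb {V A B : Type*} [Fintype V] [Ring A] [Ring B] (C : E → E → Prop) (i : K →+* A)
    (e : V → A) (α : E → A) (f : A →+* B) (p : (V → K) × (ChainList C →₀ K)) :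
    f (comb C i e α p) = comb C (f.comp i) (fun s => f (e s)) (fun a => f (α a)) p := by
  obtain ⟨c, d⟩ := p
  simp [comb_apply, map_pathElt, map_finsuppSum]

namespace IsPathFamily

variable {Q : FinQuiver.{v, w} E} {σ : E → RingAut K} {A : Type*} [Ring A]
  {i : K →+* A} {e : Q.Vertex → A} {α : E → A}

/-- Each arrow moved past `k` applies its automorphism; only the existence of the resulting scalar
matters. -/
theorem exists_pathElt_mul (h : IsPathFamily Q σ i e α) (l : List E) (k : K) :
    ∃ k', pathElt α l * i k = i k' * pathElt α l := by
  induction l generalizing k with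
  | nil => exact ⟨k, by simp⟩
  | cons a l ih =>
    obtain ⟨k', hk'⟩ := ih k
    exact ⟨σ a k', by rw [pathElt_cons, mul_assoc, hk', ← mul_assoc, h.arrow_scalar, mul_assoc]⟩

/-- Every element is a combination of vertices and admissible paths. -/
theorem comb_surjective [Fintype Q.Vertex] (h : IsPathFamily Q σ i e α)
    (hg : Generates i e α) {C : E → E → Prop} (hC : ∀ b a, ¬ C b a → α b * α a = 0) :
    Function.Surjective (comb C i e α) := by
  classical
  set S : AddSubgroup A := (comb C i e α).range with hS
  have hv (k : K) (s : Q.Vertex) : i k * e s ∈ S := by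
    refine ⟨(Pi.single s k, 0), ?_⟩
    rw [comb_apply, Finset.sum_eq_single s]
    · simp
    · intro t _ ht; simp [Pi.single_eq_of_ne ht]
    · simp
  have hp (k : K) (l : List E) (hl : l ≠ []) : i k * pathElt α l ∈ S := by
    by_cases hc : l.IsChain C
    · refine ⟨(0, Finsupp.single ⟨l, hl, hc⟩ k), ?_⟩
      rw [comb_apply, Finsupp.sum_single_index] <;> simp
    · rw [pathElt_eq_zero_of_not_isChain hC hc, mul_zero]
      exact zero_mem S
  have key (y : A) (h1 : ∀ k s, y * (i k * e s) ∈ S)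
      (h2 : ∀ k l, l ≠ [] → y * (i k * pathElt α l) ∈ S) : ∀ z ∈ S, y * z ∈ S := by
    rintro _ ⟨⟨c, d⟩, rfl⟩
    rw [comb_apply, mul_add, Finset.mul_sum, Finsupp.mul_sum]
    exact add_mem (sum_mem fun s _ => h1 _ _) (sum_mem fun l _ => h2 _ _ l.2.1)
  -- The left stabilizer of `S` is a subring. It contains the generators, hence everything, and `1 ∈
  -- S` then gives `S = A`.
  let T : Subring A :=
    { carrier := {y | ∀ z ∈ S, y * z ∈ S}
      mul_mem' := fun {a b} ha hb z hz => by rw [mul_assoc]; exact ha _ (hb _ hz)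
      one_mem' := fun z hz => by rwa [one_mul]
      add_mem' := fun {a b} ha hb z hz => by rw [add_mul]; exact add_mem (ha _ hz) (hb _ hz)
      zero_mem' := fun z _ => by rw [zero_mul]; exact zero_mem S
      neg_mem' := fun {a} ha z hz => by rw [neg_mul]; exact neg_mem (ha _ hz) }
  have hT : ∀ y, y ∈ T := by
    refine hg T (fun k => key _ ?_ ?_) (fun s => key _ ?_ ?_) (fun a => key _ ?_ ?_)
    · intro k' s
      rw [← mul_assoc, ← map_mul]
      exact hv _ _
    · intro k' l hl
      rw [← mul_assoc, ← map_mul]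
      exact hp _ _ hl
    · intro k t
      rw [← mul_assoc, h.vertex_scalar, mul_assoc, h.vertex_mul_vertex]
      split_ifs
      · exact hv _ _
      · rw [mul_zero]; exact zero_mem S
    · intro k l hl
      obtain ⟨a, l, rfl⟩ := List.exists_cons_of_ne_nil hl
      rw [← mul_assoc, h.vertex_scalar, mul_assoc, pathElt_cons, ← mul_assoc (e s),
        h.vertex_mul_arrow]
      split_ifs
      · rw [← pathElt_cons]; exact hp _ _ hl
      · rw [zero_mul, mul_zero]; exact zero_mem S
    · intro k t
      rw [← mul_assoc, h.arrow_scalar, mul_assoc, h.arrow_mul_vertex]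
      split_ifs
      · have := hp (σ a k) [a] (by simp)
        rwa [pathElt_cons, pathElt_nil, mul_one] at this
      · rw [mul_zero]; exact zero_mem S
    · intro k l hl
      rw [← mul_assoc, h.arrow_scalar, mul_assoc, ← pathElt_cons]
      exact hp _ _ (by simp)
  intro y
  have h1 : (1 : A) ∈ S := by
    rw [← h.sum_vertex]
    exact sum_mem fun s _ => by simpa using hv 1 s
  have := hT y 1 h1
  rwa [mul_one] at this

/-- The additive subgroup spanned by the paths of length at least `n`. -/
def pathFiltration (i : K →+* A) (α : E → A) (n : ℕ) : AddSubgroup A :=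
  AddSubgroup.closure {r | ∃ (k : K) (l : List E), n ≤ l.length ∧ r = i k * pathElt α l}

/-- Concatenation adds lengths, after the scalar of the right factor has been moved past the left
path. -/
theorem mul_mem_pathFiltration (h : IsPathFamily Q σ i e α) {m n : ℕ} {r t : A}
    (hr : r ∈ pathFiltration i α m) (ht : t ∈ pathFiltration i α n) :
    r * t ∈ pathFiltration i α (m + n) := by
  refine AddSubgroup.closure_induction (p := fun r _ => r * t ∈ pathFiltration i α (m + n))
    ?_ ?_ ?_ ?_ hr
  · rintro _ ⟨k, l, hl, rfl⟩
    refine AddSubgroup.closure_induction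
      (p := fun t _ => i k * pathElt α l * t ∈ pathFiltration i α (m + n)) ?_ ?_ ?_ ?_ ht
    · rintro _ ⟨k', l', hl', rfl⟩
      obtain ⟨k'', hk⟩ := h.exists_pathElt_mul l k'
      refine AddSubgroup.subset_closure ⟨k * k'', l ++ l', ?_, ?_⟩
      · rw [List.length_append]; exact add_le_add hl hl'
      · rw [mul_assoc, ← mul_assoc (pathElt α l), hk, pathElt_append, map_mul]
        simp only [mul_assoc]
    · rw [mul_zero]; exact zero_mem _
    · intro _ _ _ _ h1 h2; rw [mul_add]; exact add_mem h1 h2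
    · intro _ _ h1; rw [mul_neg]; exact neg_mem h1
  · rw [zero_mul]; exact zero_mem _
  · intro _ _ _ _ h1 h2; rw [add_mul]; exact add_mem h1 h2
  · intro _ _ h1; rw [neg_mul]; exact neg_mem h1

theorem pathFiltration_eq_bot {N : ℕ} (hN : ∀ l : List E, N ≤ l.length → pathElt α l = 0) :
    pathFiltration i α N = ⊥ := by
  rw [eq_bot_iff, pathFiltration, AddSubgroup.closure_le]
  rintro _ ⟨k, l, hl, rfl⟩
  rw [hN l hl, mul_zero]
  rfl

theorem isNilpotent_of_mem_pathFiltration (h : IsPathFamily Q σ i e α) {N : ℕ}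
    (hN : ∀ l : List E, N ≤ l.length → pathElt α l = 0) {r : A}
    (hr : r ∈ pathFiltration i α 1) : IsNilpotent r := by
  -- Positive exponents make `hr` the base case; this is why the final exponent is `N + 1`.
  have hp (n : ℕ) : r ^ (n + 1) ∈ pathFiltration i α (n + 1) := by
    induction n with
    | zero => simpa using hr
    | succ n ih => rw [pow_succ]; exact h.mul_mem_pathFiltration ih hr
  refine ⟨N + 1, ?_⟩
  have := pathFiltration_eq_bot (i := i) (fun l hl => hN l ((Nat.le_succ N).trans hl)) ▸ hp N
  simpa using this

/-- The homomorphisms `ε s` to `K` which kill all arrows and all vertices but `s`. -/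
structure IsAugmentation (Q : FinQuiver.{v, w} E) (i : K →+* A) (e : Q.Vertex → A) (α : E → A)
    (ε : Q.Vertex → A →+* K) : Prop where
  scalar (s : Q.Vertex) (k : K) : ε s (i k) = k
  vertex_self (s : Q.Vertex) : ε s (e s) = 1
  vertex_ne (s t : Q.Vertex) : t ≠ s → ε s (e t) = 0
  arrow (s : Q.Vertex) (a : E) : ε s (α a) = 0

theorem IsAugmentation.comb_apply [Fintype Q.Vertex] {ε : Q.Vertex → A →+* K}
    (hε : IsAugmentation Q i e α ε) {C : E → E → Prop} (c : Q.Vertex → K) (d : ChainList C →₀ K)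
    (s : Q.Vertex) : ε s (comb C i e α (c, d)) = c s := by
  rw [FinQuiver.comb_apply, map_add, map_sum, Finset.sum_eq_single s, map_mul, hε.scalar,
    hε.vertex_self, mul_one, map_finsuppSum, Finsupp.sum, Finset.sum_eq_zero, add_zero]
  · rintro ⟨l, hl, -⟩ -
    obtain ⟨a, l, rfl⟩ := List.exists_cons_of_ne_nil hl
    rw [pathElt_cons, map_mul, map_mul, hε.arrow, zero_mul, mul_zero]
  · intro t _ ht
    rw [map_mul, hε.vertex_ne s t ht, mul_zero]
  · simp

/-- The augmentations read off the vertex coefficients, so their common kernel is the span of the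
nontrivial paths. This makes that span visibly a two-sided ideal. -/
theorem mem_pathFiltration_one_iff (h : IsPathFamily Q σ i e α)
    (hg : Generates i e α) {ε : Q.Vertex → A →+* K} (hε : IsAugmentation Q i e α ε) (r : A) :
    r ∈ pathFiltration i α 1 ↔ ∀ s, ε s r = 0 := by
  have := Q.finite_vertex
  have := Fintype.ofFinite Q.Vertex
  constructor
  · intro hr s
    refine AddSubgroup.closure_induction (p := fun r _ => ε s r = 0) ?_ ?_ ?_ ?_ hr
    · rintro _ ⟨k, l, hl, rfl⟩
      obtain ⟨a, l, rfl⟩ := List.exists_cons_of_length_pos hl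
      rw [pathElt_cons, map_mul, map_mul, hε.arrow, zero_mul, mul_zero]
    · exact map_zero _
    · intro _ _ _ _ h1 h2; rw [map_add, h1, h2, add_zero]
    · intro _ _ h1; rw [map_neg, h1, neg_zero]
  · intro hr
    obtain ⟨⟨c, d⟩, rfl⟩ := h.comb_surjective hg (C := fun _ _ => True)
      (fun b a hba => absurd trivial hba) r
    have hc : c = 0 := funext fun s => by rw [← hε.comb_apply c d s, hr s]; rfl
    rw [hc, FinQuiver.comb_apply]
    simp only [Pi.zero_apply, map_zero, zero_mul, Finset.sum_const_zero, zero_add]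
    exact sum_mem fun l _ => AddSubgroup.subset_closure
      ⟨_, l.1, List.length_pos_iff.mpr l.2.1, rfl⟩

/-- If long paths vanish, then the radical is spanned by the nontrivial paths. -/
theorem mem_jacobson_iff (h : IsPathFamily Q σ i e α)
    (hg : Generates i e α) {ε : Q.Vertex → A →+* K} (hε : IsAugmentation Q i e α ε) {N : ℕ}
    (hN : ∀ l : List E, N ≤ l.length → pathElt α l = 0) (r : A) :
    r ∈ Ring.jacobson A ↔ r ∈ pathFiltration i α 1 := by
  constructor
  · intro hr
    rw [h.mem_pathFiltration_one_iff hg hε]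
    intro s
    -- A surjection maps the radical into the radical, which is zero for the division ring `K`.
    have : RingHomSurjective (ε s) := ⟨fun k => ⟨i k, hε.scalar s k⟩⟩
    have := Ring.le_comap_jacobson (ε s) hr
    rw [Ideal.mem_comap, IsSemisimpleRing.jacobson_eq_bot] at this
    exact this
  · intro hr
    rw [← Ideal.jacobson_bot, Ideal.mem_jacobson_iff]
    intro y
    -- Then `y * r` is nilpotent and `y * r + 1` is invertible, for every `y`.
    have hy : y * r ∈ pathFiltration i α 1 := by
      rw [h.mem_pathFiltration_one_iff hg hε] at hr ⊢
      intro s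
      rw [map_mul, hr s, mul_zero]
    obtain ⟨u, hu⟩ := (h.isNilpotent_of_mem_pathFiltration hN hy).isUnit_add_one
    refine ⟨↑u⁻¹, ?_⟩
    rw [Ideal.mem_bot, mul_assoc, sub_eq_zero, ← mul_add_one, ← hu, Units.inv_mul]

end IsPathFamily

end FinQuiver

/-! ### The action of the path ring on the space of paths -/

namespace FinQuiver

variable {E : Type v} {K : Type u} [DivisionRing K]

theorem end_mul_apply {M : Type*} [AddCommGroup M] (f g : AddMonoid.End M) (m : M) :
    (f * g) m = f (g m) := rfl

theorem end_sum_apply {ι M : Type*} [AddCommGroup M] (t : Finset ι) (f : ι → AddMonoid.End M)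
    (m : M) : (∑ j ∈ t, f j) m = ∑ j ∈ t, f j m :=
  AddMonoidHom.finsetSum_apply _ _ _

theorem end_ext {M : Type*} [AddCommGroup M] {f g : AddMonoid.End M} (h : ∀ m, f m = g m) :
    f = g :=
  AddMonoidHom.ext h

/-- The pairs `(l, s)` stand for the path with the list of arrows `l` which starts at `s`. -/
abbrev PathSpace (Q : FinQuiver.{v, w} E) (K : Type u) [DivisionRing K] : Type (max u v w) :=
  (List E × Q.Vertex) →₀ K

theorem toAddMonoidEnd_pathSpace_apply (Q : FinQuiver.{v, w} E) (k : K) (m : PathSpace Q K) :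
    Module.toAddMonoidEnd K (PathSpace Q K) k m = k • m := rfl

theorem end_ext_single {Q : FinQuiver.{v, w} E} {f g : AddMonoid.End (PathSpace Q K)}
    (h : ∀ p k, f (Finsupp.single p k) = g (Finsupp.single p k)) : f = g :=
  Finsupp.addHom_ext h

/-- The vertex where a path ends. -/
def endpoint (Q : FinQuiver.{v, w} E) : List E × Q.Vertex → Q.Vertex
  | ([], s) => s
  | (a :: _, _) => Q.head a

open Classical in
/-- The action of a vertex on the space of paths. -/
noncomputable def actVertex (Q : FinQuiver.{v, w} E) (s : Q.Vertex) :
    AddMonoid.End (PathSpace Q K) :=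
  Finsupp.filterAddHom fun p => Q.endpoint p = s

open Classical in
/-- The action of an arrow on the space of paths. -/
noncomputable def actArrow (Q : FinQuiver.{v, w} E) (σ : E → RingAut K) (a : E) :
    AddMonoid.End (PathSpace Q K) :=
  Finsupp.liftAddHom fun p => if Q.endpoint p = Q.tail a then
    (Finsupp.singleAddHom (a :: p.1, p.2)).comp (σ a : K →+* K).toAddMonoidHom else 0

open Classical in
theorem actVertex_single (Q : FinQuiver.{v, w} E) (s : Q.Vertex) (p : List E × Q.Vertex) (k : K) :
    actVertex Q s (Finsupp.single p k) = if Q.endpoint p = s then Finsupp.single p k else 0 := by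
  split_ifs with h
  · exact Finsupp.filter_single_of_pos _ h
  · exact Finsupp.filter_single_of_neg _ h

open Classical in
theorem actArrow_single (Q : FinQuiver.{v, w} E) (σ : E → RingAut K) (a : E)
    (p : List E × Q.Vertex) (k : K) :
    actArrow Q σ a (Finsupp.single p k) =
      if Q.endpoint p = Q.tail a then Finsupp.single (a :: p.1, p.2) (σ a k) else 0 := by
  refine (Finsupp.liftAddHom_apply_single _ _ _).trans ?_
  split_ifs <;> rfl

open Classical in
theorem actVertex_apply (Q : FinQuiver.{v, w} E) (s : Q.Vertex) (m : PathSpace Q K)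
    (p : List E × Q.Vertex) :
    actVertex Q s m p = if Q.endpoint p = s then m p else 0 :=
  Finsupp.filter_apply _ _ _

open Classical in
theorem actArrow_apply_cons (Q : FinQuiver.{v, w} E) (σ : E → RingAut K) (b : E)
    (m : PathSpace Q K) (a : E) (l : List E) (s : Q.Vertex) :
    actArrow Q σ b m (a :: l, s) =
      if b = a ∧ Q.endpoint (l, s) = Q.tail a then σ a (m (l, s)) else 0 := by
  induction m using Finsupp.induction_linear with
  | zero => simp
  | add m n hm hn =>
    rw [map_add, Finsupp.add_apply, hm, hn]
    split_ifs <;> simp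
  | single p k =>
    obtain ⟨l', s'⟩ := p
    rw [actArrow_single]
    by_cases hp : (l', s') = (l, s)
    · cases hp
      by_cases hb : b = a
      · subst hb
        by_cases ht : Q.endpoint (l, s) = Q.tail b <;> simp [ht]
      · rw [if_neg (fun h : b = a ∧ _ => hb h.1)]
        split_ifs
        · rw [Finsupp.single_apply, if_neg]
          intro h
          simp only [Prod.mk.injEq, List.cons.injEq] at h
          exact hb h.1.1
        · rfl
    · rw [Finsupp.single_apply (a := (l', s')), if_neg hp, map_zero,
        ite_self (c := b = a ∧ Q.endpoint (l, s) = Q.tail a)]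
      split_ifs
      · rw [Finsupp.single_apply, if_neg]
        intro h
        simp only [Prod.mk.injEq, List.cons.injEq] at h
        exact hp (Prod.ext h.1.2 h.2)
      · rfl

/-- The basis consists of all pairs of a list and a vertex, composable or not. The generators only
look at the endpoint, so the relations hold on the whole space and no type of genuine paths is
needed. -/
theorem isPathFamily_act (Q : FinQuiver.{v, w} E) (σ : E → RingAut K) :
    IsPathFamily Q σ (Module.toAddMonoidEnd K (PathSpace Q K)) (actVertex Q) (actArrow Q σ) where
  vertex_sum := by
    have := Q.finite_vertex
    have := Fintype.ofFinite Q.Vertex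
    rw [finsum_eq_sum_of_fintype]
    refine end_ext fun m => Finsupp.ext fun p => ?_
    rw [end_sum_apply, Finsupp.finsetSum_apply, AddMonoid.End.coe_one, id_eq,
      Finset.sum_congr rfl fun s _ => actVertex_apply Q s m p, Finset.sum_eq_single (Q.endpoint p),
      if_pos rfl]
    · intro t _ ht
      exact if_neg ht.symm
    · simp
  vertex_idem s := by
    refine end_ext fun m => Finsupp.ext fun p => ?_
    rw [end_mul_apply, actVertex_apply, actVertex_apply]
    split_ifs <;> rfl
  vertex_orth s t h := by
    refine end_ext fun m => Finsupp.ext fun p => ?_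
    rw [end_mul_apply, actVertex_apply, actVertex_apply]
    split_ifs with h1 h2
    · exact absurd (h1.symm.trans h2) h
    · rfl
    · rfl
  vertex_scalar s k := by
    refine end_ext fun m => Finsupp.ext fun p => ?_
    rw [end_mul_apply, end_mul_apply, actVertex_apply,
      toAddMonoidEnd_pathSpace_apply, toAddMonoidEnd_pathSpace_apply, Finsupp.smul_apply,
      Finsupp.smul_apply, actVertex_apply]
    split_ifs <;> simp
  head_arrow a := by
    refine end_ext_single fun p k => ?_
    rw [end_mul_apply, actArrow_single]
    split_ifs
    · rw [actVertex_single]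
      exact if_pos rfl
    · exact map_zero _
  arrow_tail a := by
    refine end_ext_single fun p k => ?_
    rw [end_mul_apply, actVertex_single]
    split_ifs with h
    · rfl
    · rw [actArrow_single, if_neg h, map_zero]
  arrow_scalar a k := by
    refine end_ext_single fun p k' => ?_
    rw [end_mul_apply, end_mul_apply, actArrow_single,
      toAddMonoidEnd_pathSpace_apply, toAddMonoidEnd_pathSpace_apply, Finsupp.smul_single,
      actArrow_single]
    split_ifs
    · rw [Finsupp.smul_single, smul_eq_mul, smul_eq_mul, map_mul]
    · rw [smul_zero]

open Classical in
/-- Precomposition of paths with an arrow. -/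
noncomputable def precomp (Q : FinQuiver.{v, w} E) (a : E) :
    AddMonoid.End (PathSpace Q K) :=
  Finsupp.liftAddHom fun p => if p.2 = Q.head a then
    Finsupp.singleAddHom (p.1 ++ [a], Q.tail a) else 0

open Classical in
theorem precomp_single (Q : FinQuiver.{v, w} E) (a : E) (p : List E × Q.Vertex) (k : K) :
    precomp Q a (Finsupp.single p k) =
      if p.2 = Q.head a then Finsupp.single (p.1 ++ [a], Q.tail a) k else 0 := by
  refine (Finsupp.liftAddHom_apply_single _ _ _).trans ?_
  split_ifs <;> rfl

open Classical in
theorem precomp_apply_append (Q : FinQuiver.{v, w} E) (b a : E) (m : PathSpace Q K) (l : List E) :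
    precomp Q b m (l ++ [a], Q.tail a) = if b = a then m (l, Q.head a) else 0 := by
  induction m using Finsupp.induction_linear with
  | zero => simp
  | add m n hm hn =>
    rw [map_add, Finsupp.add_apply, hm, hn]
    split_ifs <;> simp
  | single p k =>
    obtain ⟨l', s'⟩ := p
    rw [precomp_single]
    by_cases hb : b = a
    · subst hb
      by_cases hs : s' = Q.head b
      · subst hs
        simp [Finsupp.single_apply]
      · simp [hs]
    · rw [if_neg hb]
      split_ifs
      · rw [Finsupp.single_apply, if_neg]
        intro h
        exact hb (by simpa using (List.append_inj' (Prod.ext_iff.mp h).1 rfl).2)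
      · rfl

theorem endpoint_append (Q : FinQuiver.{v, w} E) (a : E) (l : List E) :
    Q.endpoint (l ++ [a], Q.tail a) = Q.endpoint (l, Q.head a) := by
  cases l <;> rfl

/-- Left multiplication acts at the end of a path and precomposition at its start, so they commute;
this is checked on generators. -/
theorem lift_precomp (Q : FinQuiver.{v, w} E) (σ : E → RingAut K) (a : E)
    (r : PathRing Q σ) (m : PathSpace Q K) :
    (Q.isPathFamily_act σ).lift r (precomp Q a m) =
      precomp Q a ((Q.isPathFamily_act σ).lift r m) := by
  classical
  let S : Subring (AddMonoid.End (PathSpace Q K)) :=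
    Subring.centralizer {precomp Q a}
  have hS : ∀ r, r ∈ S.comap (Q.isPathFamily_act σ).lift := by
    refine Q.generates σ _ (fun k => ?_) (fun s => ?_) (fun b => ?_)
    · rw [Subring.mem_comap, IsPathFamily.lift_scalar, Subring.mem_centralizer_iff]
      rintro _ rfl
      refine end_ext_single fun p k' => ?_
      rw [end_mul_apply, end_mul_apply, precomp_single,
        toAddMonoidEnd_pathSpace_apply, toAddMonoidEnd_pathSpace_apply, Finsupp.smul_single,
        precomp_single]
      split_ifs
      · rw [Finsupp.smul_single]
      · rw [smul_zero]
    · rw [Subring.mem_comap, IsPathFamily.lift_vert, Subring.mem_centralizer_iff]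
      rintro _ rfl
      refine end_ext_single fun ⟨l, t⟩ k' => ?_
      rw [end_mul_apply, end_mul_apply, precomp_single, actVertex_single]
      by_cases ht : t = Q.head a
      · subst ht
        rw [if_pos rfl, actVertex_single, endpoint_append]
        split_ifs
        · rw [precomp_single, if_pos rfl]
        · rw [map_zero]
      · rw [if_neg ht, map_zero]
        split_ifs
        · rw [precomp_single, if_neg ht]
        · rw [map_zero]
    · rw [Subring.mem_comap, IsPathFamily.lift_arrow, Subring.mem_centralizer_iff]
      rintro _ rfl
      refine end_ext_single fun ⟨l, t⟩ k' => ?_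
      rw [end_mul_apply, end_mul_apply, precomp_single, actArrow_single]
      by_cases ht : t = Q.head a
      · subst ht
        rw [if_pos rfl, actArrow_single, endpoint_append]
        split_ifs
        · rw [precomp_single, if_pos rfl]; rfl
        · rw [map_zero]
      · rw [if_neg ht, map_zero]
        split_ifs
        · rw [precomp_single, if_neg ht]
        · rw [map_zero]
  have h := Subring.mem_centralizer_iff.mp (hS r) _ rfl
  exact (DFunLike.congr_fun h m).symm

open Classical in
theorem lift_filter (Q : FinQuiver.{v, w} E) (σ : E → RingAut K) (s : Q.Vertex)
    (r : PathRing Q σ) (m : PathSpace Q K) :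
    (Q.isPathFamily_act σ).lift r (m.filter fun p => p.2 = s) =
      ((Q.isPathFamily_act σ).lift r m).filter fun p => p.2 = s := by
  let F : AddMonoid.End (PathSpace Q K) := Finsupp.filterAddHom fun p => p.2 = s
  have hF (p : List E × Q.Vertex) (k : K) :
      F (Finsupp.single p k) = if p.2 = s then Finsupp.single p k else 0 := by
    split_ifs with h
    · exact Finsupp.filter_single_of_pos _ h
    · exact Finsupp.filter_single_of_neg _ h
  let S : Subring (AddMonoid.End (PathSpace Q K)) := Subring.centralizer {F}
  have hS : ∀ r, r ∈ S.comap (Q.isPathFamily_act σ).lift := by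
    refine Q.generates σ _ (fun k => ?_) (fun t => ?_) (fun b => ?_)
    · rw [Subring.mem_comap, IsPathFamily.lift_scalar, Subring.mem_centralizer_iff]
      rintro _ rfl
      refine end_ext_single fun p k' => ?_
      rw [end_mul_apply, end_mul_apply, hF,
        toAddMonoidEnd_pathSpace_apply, toAddMonoidEnd_pathSpace_apply, Finsupp.smul_single,
        hF]
      split_ifs
      · rw [Finsupp.smul_single]
      · rw [smul_zero]
    · rw [Subring.mem_comap, IsPathFamily.lift_vert, Subring.mem_centralizer_iff]
      rintro _ rfl
      refine end_ext_single fun p k' => ?_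
      rw [end_mul_apply, end_mul_apply, hF, actVertex_single]
      split_ifs with h1 h2 h2
      · rw [hF, actVertex_single, if_pos h1, if_pos h2]
      · rw [hF, if_neg h2, map_zero]
      · rw [actVertex_single, if_neg h1, map_zero]
      · rw [map_zero, map_zero]
    · rw [Subring.mem_comap, IsPathFamily.lift_arrow, Subring.mem_centralizer_iff]
      rintro _ rfl
      refine end_ext_single fun p k' => ?_
      rw [end_mul_apply, end_mul_apply, hF, actArrow_single]
      split_ifs with h1 h2 h2
      · rw [hF, actArrow_single, if_pos h1, if_pos h2]
      · rw [hF, if_neg h2, map_zero]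
      · rw [actArrow_single, if_neg h1, map_zero]
      · rw [map_zero, map_zero]
  have h := Subring.mem_centralizer_iff.mp (hS r) _ rfl
  exact (DFunLike.congr_fun h m).symm

/-- The sum of all trivial paths. -/
noncomputable def trivialPaths (Q : FinQuiver.{v, w} E) [Fintype Q.Vertex] : PathSpace Q K :=
  ∑ s, Finsupp.single ([], s) 1

/-- The expansion of an element of the path ring in the basis of paths. -/
noncomputable def expand (Q : FinQuiver.{v, w} E) [Fintype Q.Vertex] (σ : E → RingAut K) :
    PathRing Q σ →+ PathSpace Q K :=
  (AddMonoidHom.eval (trivialPaths Q)).comp (Q.isPathFamily_act σ).lift.toAddMonoidHom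

/-! ### Coefficients in the basis of paths -/

section expand

variable (Q : FinQuiver.{v, w} E) [Fintype Q.Vertex] (σ : E → RingAut K)

theorem expand_apply (r : PathRing Q σ) :
    Q.expand σ r = (Q.isPathFamily_act σ).lift r (trivialPaths Q) := rfl

theorem expand_mul (r t : PathRing Q σ) :
    Q.expand σ (r * t) = (Q.isPathFamily_act σ).lift r (Q.expand σ t) := by
  rw [expand_apply, map_mul]; rfl

theorem expand_scalar_mul (k : K) (r : PathRing Q σ) :
    Q.expand σ (Q.scalarHom σ k * r) = k • Q.expand σ r := by
  rw [expand_mul, IsPathFamily.lift_scalar]; rfl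

theorem expand_vert_mul (s : Q.Vertex) (r : PathRing Q σ) :
    Q.expand σ (Q.vert σ s * r) = actVertex Q s (Q.expand σ r) := by
  rw [expand_mul, IsPathFamily.lift_vert]

theorem expand_arrow_mul (a : E) (r : PathRing Q σ) :
    Q.expand σ (Q.arrow σ a * r) = actArrow Q σ a (Q.expand σ r) := by
  rw [expand_mul, IsPathFamily.lift_arrow]

theorem expand_one : Q.expand σ 1 = trivialPaths Q := by
  rw [expand_apply, map_one]; rfl

theorem expand_vert (s : Q.Vertex) : Q.expand σ (Q.vert σ s) = Finsupp.single ([], s) 1 := by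
  classical
  rw [← mul_one (Q.vert σ s), expand_vert_mul, expand_one, trivialPaths, map_sum,
    Finset.sum_eq_single s]
  · rw [actVertex_single]; exact if_pos rfl
  · intro t _ ht
    rw [actVertex_single]; exact if_neg ht
  · simp

theorem expand_arrow (a : E) : Q.expand σ (Q.arrow σ a) = Finsupp.single ([a], Q.tail a) 1 := by
  classical
  rw [← (Q.isPathFamily σ).arrow_tail a, expand_arrow_mul, expand_vert, actArrow_single, map_one]
  exact if_pos rfl

theorem expand_pathElt {l : List E} (hl : l ≠ [])
    (hc : l.IsChain fun b a => Q.tail b = Q.head a) :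
    Q.expand σ (pathElt (Q.arrow σ) l) = Finsupp.single (l, Q.tail (l.getLast hl)) 1 := by
  classical
  induction l with
  | nil => exact absurd rfl hl
  | cons b l ih =>
    cases l with
    | nil => simpa using Q.expand_arrow σ b
    | cons a l =>
      rw [List.isChain_cons_cons] at hc
      rw [pathElt_cons, expand_arrow_mul, ih (by simp) hc.2, actArrow_single, map_one]
      refine (if_pos hc.1.symm).trans ?_
      rw [List.getLast_cons (List.cons_ne_nil a l)]

theorem expand_comb {C : E → E → Prop} (hC : ∀ b a, C b a → Q.tail b = Q.head a)
    (c : Q.Vertex → K) (d : ChainList C →₀ K) :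
    Q.expand σ (comb C (Q.scalarHom σ) (Q.vert σ) (Q.arrow σ) (c, d)) =
      ∑ s, Finsupp.single ([], s) (c s) +
        d.sum fun l k => Finsupp.single (l.1, Q.tail (l.1.getLast l.2.1)) k := by
  rw [comb_apply, map_add, map_sum, map_finsuppSum]
  congr 1
  · refine Finset.sum_congr rfl fun s _ => ?_
    rw [expand_scalar_mul, expand_vert, Finsupp.smul_single, smul_eq_mul, mul_one]
  · refine Finsupp.sum_congr fun l _ => ?_
    rw [expand_scalar_mul, expand_pathElt Q σ l.2.1 (l.2.2.imp hC), Finsupp.smul_single,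
      smul_eq_mul, mul_one]

theorem expand_comb_apply_nil {C : E → E → Prop} (hC : ∀ b a, C b a → Q.tail b = Q.head a)
    (c : Q.Vertex → K) (d : ChainList C →₀ K) (s : Q.Vertex) :
    Q.expand σ (comb C (Q.scalarHom σ) (Q.vert σ) (Q.arrow σ) (c, d)) ([], s) = c s := by
  classical
  rw [expand_comb Q σ hC, Finsupp.add_apply, Finsupp.finsetSum_apply, Finset.sum_eq_single s,
    Finsupp.single_eq_same, Finsupp.sum, Finsupp.finsetSum_apply, Finset.sum_eq_zero, add_zero]
  · intro l _
    rw [Finsupp.single_apply, if_neg]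
    exact fun h => l.2.1 (Prod.ext_iff.mp h).1
  · intro t _ ht
    rw [Finsupp.single_apply, if_neg]
    exact fun h => ht (Prod.ext_iff.mp h).2
  · simp

theorem expand_comb_apply_path {C : E → E → Prop} (hC : ∀ b a, C b a → Q.tail b = Q.head a)
    (c : Q.Vertex → K) (d : ChainList C →₀ K) (l : ChainList C) :
    Q.expand σ (comb C (Q.scalarHom σ) (Q.vert σ) (Q.arrow σ) (c, d))
      (l.1, Q.tail (l.1.getLast l.2.1)) = d l := by
  classical
  rw [expand_comb Q σ hC, Finsupp.add_apply, Finsupp.finsetSum_apply, Finset.sum_eq_zero,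
    zero_add, Finsupp.sum, Finsupp.finsetSum_apply, Finset.sum_eq_single l,
    Finsupp.single_eq_same]
  · intro m _ hm
    rw [Finsupp.single_apply, if_neg]
    exact fun h => hm (Subtype.ext (Prod.ext_iff.mp h).1)
  · intro hl
    rw [Finsupp.notMem_support_iff.mp hl, Finsupp.single_zero, Finsupp.zero_apply]
  · intro t _
    rw [Finsupp.single_apply, if_neg]
    exact fun h => l.2.1 (Prod.ext_iff.mp h).1.symm

/-- The vertices and the paths are linearly independent. -/
theorem comb_injective {C : E → E → Prop} (hC : ∀ b a, C b a → Q.tail b = Q.head a) :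
    Function.Injective (comb C (Q.scalarHom σ) (Q.vert σ) (Q.arrow σ)) := by
  rw [injective_iff_map_eq_zero]
  rintro ⟨c, d⟩ h
  refine Prod.ext (funext fun s => ?_) (Finsupp.ext fun l => ?_)
  · refine (Q.expand_comb_apply_nil σ hC c d s).symm.trans ?_
    rw [h, map_zero]; rfl
  · refine (Q.expand_comb_apply_path σ hC c d l).symm.trans ?_
    rw [h, map_zero]; rfl

/-- Vertices and composable paths span, and their coefficients can be read back from the expansion.
Identities in the path ring can thus be compared coefficientwise. -/
theorem expand_injective : Function.Injective (Q.expand σ) := by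
  rw [injective_iff_map_eq_zero]
  intro r hr
  obtain ⟨⟨c, d⟩, rfl⟩ := (Q.isPathFamily σ).comb_surjective (Q.generates σ)
    (C := fun b a => Q.tail b = Q.head a)
    (fun b a hba => (Q.isPathFamily σ).arrow_mul_arrow_eq_zero hba) r
  have hc : (c, d) = 0 := by
    refine Prod.ext (funext fun s => ?_) (Finsupp.ext fun l => ?_)
    · refine (Q.expand_comb_apply_nil σ (fun _ _ h => h) c d s).symm.trans ?_
      rw [hr]; rfl
    · refine (Q.expand_comb_apply_path σ (fun _ _ h => h) c d l).symm.trans ?_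
      rw [hr]; rfl
  rw [hc, map_zero]

/-- Left multiplication by the arrows is injective. -/
theorem vert_mul_eq_zero_of_sum_arrow_mul_eq_zero [Fintype E] (z : E → PathRing Q σ)
    (hz : ∑ a, Q.arrow σ a * z a = 0) (a : E) : Q.vert σ (Q.tail a) * z a = 0 := by
  classical
  apply Q.expand_injective σ
  rw [map_zero, expand_vert_mul]
  refine Finsupp.ext fun ⟨l, s⟩ => ?_
  rw [actVertex_apply]
  split_ifs with hs
  -- At a word beginning with `a` only the summand of `a` contributes.
  · have h := DFunLike.congr_fun (congrArg (Q.expand σ) hz) (a :: l, s)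
    rw [map_sum, Finsupp.finsetSum_apply, Finset.sum_eq_single a, expand_arrow_mul,
      actArrow_apply_cons, if_pos ⟨rfl, hs⟩, map_zero, Finsupp.zero_apply,
      EmbeddingLike.map_eq_zero_iff] at h
    · exact h
    · intro b _ hb
      rw [expand_arrow_mul, actArrow_apply_cons, if_neg (fun h => hb h.1)]
    · simp
  · rfl

theorem expand_mul_arrow (r : PathRing Q σ) (a : E) :
    Q.expand σ (r * Q.arrow σ a) = precomp Q a (Q.expand σ r) := by
  classical
  rw [expand_mul, expand_arrow, expand_apply, ← lift_precomp, trivialPaths, map_sum,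
    Finset.sum_eq_single (Q.head a)]
  · rw [precomp_single, if_pos rfl]; rfl
  · intro t _ ht
    rw [precomp_single, if_neg ht]
  · simp

open Classical in
theorem expand_mul_vert (r : PathRing Q σ) (s : Q.Vertex) :
    Q.expand σ (r * Q.vert σ s) = (Q.expand σ r).filter fun p => p.2 = s := by
  rw [expand_mul, expand_vert, expand_apply, ← lift_filter]
  congr 1
  refine Finsupp.ext fun ⟨l, t⟩ => ?_
  rw [Finsupp.filter_apply, trivialPaths, Finsupp.finsetSum_apply, Finsupp.single_apply]
  by_cases ht : t = s
  · subst ht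
    rw [if_pos rfl, Finset.sum_eq_single t]
    · rw [Finsupp.single_apply]
    · intro t' _ ht'
      rw [Finsupp.single_apply, if_neg]
      exact fun h => ht' (Prod.ext_iff.mp h).2
    · simp
  · rw [if_neg ht, if_neg]
    exact fun h => ht (Prod.ext_iff.mp h).2.symm

/-- Right multiplication by the arrows is injective. -/
theorem mul_vert_eq_zero_of_sum_mul_arrow_eq_zero [Fintype E] (z : E → PathRing Q σ)
    (hz : ∑ a, z a * Q.arrow σ a = 0) (a : E) : z a * Q.vert σ (Q.head a) = 0 := by
  classical
  apply Q.expand_injective σ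
  rw [map_zero, expand_mul_vert]
  refine Finsupp.ext fun ⟨l, s⟩ => ?_
  rw [Finsupp.filter_apply]
  split_ifs with hs
  · have hs' : s = Q.head a := hs
    subst hs'
    -- At a word whose last letter is `a` only the summand of `a` contributes.
    have h := DFunLike.congr_fun (congrArg (Q.expand σ) hz) (l ++ [a], Q.tail a)
    rw [map_sum, Finsupp.finsetSum_apply, Finset.sum_eq_single a, expand_mul_arrow,
      precomp_apply_append, if_pos rfl, map_zero, Finsupp.zero_apply] at h
    · exact h
    · intro b _ hb
      rw [expand_mul_arrow, precomp_apply_append, if_neg hb]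
    · simp
  · rfl

end expand

end FinQuiver

/-! ### A projectivity criterion -/

/-- If every element of `M` is a combination of multiples of the `α a`, and long products of the
`α a` vanish, then `M` is zero. -/
theorem eq_zero_of_forall_exists_sum_smul {E R M : Type*} [Fintype E] [Ring R] [AddCommGroup M]
    [Module R M] (α : E → R) {n : ℕ} (hn : ∀ l : List E, l.length = n → (l.map α).prod = 0)
    (h : ∀ m : M, ∃ f : E → M, m = ∑ a, α a • f a) (m : M) : m = 0 := by
  -- Nakayama's argument: using `h` repeatedly writes every element by words of length `k`, and
  -- words of length `n` act as zero.
  have key (k : ℕ) : ∀ m : M, m ∈ AddSubgroup.closure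
      {x : M | ∃ (l : List E) (y : M), l.length = k ∧ x = (l.map α).prod • y} := by
    induction k with
    | zero => exact fun m => AddSubgroup.subset_closure ⟨[], m, rfl, by simp⟩
    | succ k ih =>
      intro m
      refine (AddSubgroup.closure_le _).mpr ?_ (ih m)
      rintro _ ⟨l, y, hl, rfl⟩
      obtain ⟨f, rfl⟩ := h y
      rw [Finset.smul_sum]
      refine sum_mem fun a _ => AddSubgroup.subset_closure ⟨l ++ [a], f a, by simp [hl], ?_⟩
      simp [mul_smul]
  refine AddSubgroup.closure_induction (p := fun m _ => m = 0) ?_ rfl ?_ ?_ (key n m)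
  · rintro _ ⟨l, y, hl, rfl⟩
    rw [hn l hl, zero_smul]
  · rintro _ _ _ _ rfl rfl; exact add_zero 0
  · rintro _ _ rfl; exact neg_zero

/-- A ring with a complete family of orthogonal idempotents `e s` and with elements `α a` which,
together with the image of a division ring, generate it; long products of the `α a` vanish. -/
structure IsArrowSystem {V E K R : Type*} [Fintype V] [Fintype E] [DivisionRing K] [Ring R]
    (i : K →+* R) (e : V → R) (α : E → R) (head tail : E → V) : Prop where
  vertex_sum : ∑ s, e s = 1
  vertex_idem (s : V) : e s * e s = e s
  vertex_orth (s t : V) : s ≠ t → e s * e t = 0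
  vertex_scalar (s : V) (k : K) : e s * i k = i k * e s
  head_arrow (a : E) : e (head a) * α a = α a
  arrow_tail (a : E) : α a * e (tail a) = α a
  scalar_arrow (a : E) (k : K) : ∃ k', i k * α a = α a * i k'
  decomp (r : R) : ∃ (c : V → K) (z : E → R), r = ∑ s, i (c s) * e s + ∑ a, α a * z a
  nilpotent : ∃ n, ∀ l : List E, l.length = n → (l.map α).prod = 0

namespace IsArrowSystem

variable {V E K R : Type*} [Fintype V] [Fintype E] [DivisionRing K] [Ring R]
  {i : K →+* R} {e : V → R} {α : E → R} {head tail : E → V}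

/-- A basis of the top of a module, lifted to elements which are homogeneous for the idempotents. -/
theorem exists_top_basis (h : IsArrowSystem i e α head tail) (M : Type x) [AddCommGroup M]
    [Module R M] :
    ∃ (B : Type x) (b : B → M) (s : B → V), (∀ j, e (s j) • b j = b j) ∧
      (∀ (c : B →₀ K) (f : E → M), (c.sum fun j k => i k • b j) = ∑ a, α a • f a → c = 0) ∧
      (∀ m : M, ∃ (c : B →₀ K) (f : E → M),
        m = (c.sum fun j k => i k • b j) + ∑ a, α a • f a) := by
  let : Module K M := Module.compHom M i
  have hK (k : K) (m : M) : k • m = i k • m := rfl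
  -- `D` plays the role of the radical of `M`; `scalar_arrow` makes it stable under `K`.
  let D : Submodule K M :=
    { carrier := {m | ∃ f : E → M, m = ∑ a, α a • f a}
      add_mem' := by
        rintro _ _ ⟨f, rfl⟩ ⟨g, rfl⟩
        exact ⟨f + g, by simp [Finset.sum_add_distrib]⟩
      zero_mem' := ⟨0, by simp⟩
      smul_mem' := by
        rintro k _ ⟨f, rfl⟩
        choose k' hk' using fun a => h.scalar_arrow a k
        refine ⟨fun a => i (k' a) • f a, ?_⟩
        rw [hK, Finset.smul_sum]
        refine Finset.sum_congr rfl fun a _ => ?_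
        rw [← mul_smul, ← mul_smul, hk'] }
  -- A basis of `M ⧸ D` is extracted from the classes of homogeneous elements, so that each basis
  -- vector lifts to an element fixed by some `e s`.
  let T : Set (M ⧸ D) := {x | ∃ (s : V) (m : M), e s • m = m ∧ D.mkQ m = x}
  obtain ⟨B, hBT, hspan, hli⟩ := exists_linearIndependent K T
  choose s b hb hbq using fun j : B => hBT j.2
  have hsum (c : B →₀ K) : D.mkQ (c.sum fun j k => i k • b j) =
      Finsupp.linearCombination K (Subtype.val : B → M ⧸ D) c := by
    rw [Finsupp.linearCombination_apply, map_finsuppSum]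
    refine Finsupp.sum_congr fun j _ => ?_
    rw [← hbq j, ← hK, map_smul]
  refine ⟨B, b, s, hb, fun c f hc => ?_, fun m => ?_⟩
  · have h0 : D.mkQ (c.sum fun j k => i k • b j) = 0 :=
      (Submodule.Quotient.mk_eq_zero D).mpr ⟨f, hc⟩
    rw [hsum] at h0
    exact (linearIndependent_iff.mp hli) c h0
  · have hm : D.mkQ m ∈ Submodule.span K B := by
      rw [hspan]
      have : m = ∑ s, e s • m := by rw [← Finset.sum_smul, h.vertex_sum, one_smul]
      rw [this, map_sum]
      refine sum_mem fun s _ => Submodule.subset_span ⟨s, e s • m, ?_, rfl⟩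
      rw [← mul_smul, h.vertex_idem]
    rw [← Subtype.range_coe (s := B), Finsupp.mem_span_range_iff_exists_finsupp] at hm
    obtain ⟨c, hc⟩ := hm
    rw [← Finsupp.linearCombination_apply, ← hsum, eq_comm, ← sub_eq_zero, ← map_sub] at hc
    obtain ⟨f, hf⟩ := (Submodule.Quotient.mk_eq_zero D).mp hc
    exact ⟨c, f, (add_sub_cancel _ m).symm.trans (congrArg _ hf)⟩

/-- A module on which the arrows act jointly injectively is projective. -/
theorem projective (h : IsArrowSystem i e α head tail) (M : Type*) [AddCommGroup M]
    [Module R M]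
    (hM : ∀ m : E → M, ∑ a, α a • m a = 0 → ∀ a, e (tail a) • m a = 0) :
    Module.Projective R M := by
  classical
  obtain ⟨n, hn⟩ := h.nilpotent
  obtain ⟨B, b, s, hb, hli, hspan⟩ := h.exists_top_basis M
  let Φ : (B →₀ R) →ₗ[R] M := Finsupp.linearCombination R b
  -- `π` is the projection onto the direct sum of the `R e (s j)`. Its range `P` is projective, and
  -- `Φ` restricted to `P` will be an isomorphism onto `M`.
  let π : (B →₀ R) →ₗ[R] (B →₀ R) :=
    Finsupp.linearCombination R fun j => Finsupp.single j (e (s j))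
  have hΦ (j : B) (r : R) : Φ (Finsupp.single j r) = r • b j :=
    Finsupp.linearCombination_single _ _ _
  have hπ (j : B) (r : R) : π (Finsupp.single j r) = Finsupp.single j (r * e (s j)) := by
    rw [Finsupp.linearCombination_single, Finsupp.smul_single, smul_eq_mul]
  have hππ (y : B →₀ R) : π (π y) = π y := by
    have : π ∘ₗ π = π := Finsupp.lhom_ext fun j r => by
      rw [LinearMap.comp_apply, hπ, hπ, mul_assoc, h.vertex_idem]
    exact LinearMap.congr_fun this y
  have hΦπ (y : B →₀ R) : Φ (π y) = Φ y := by
    have : Φ ∘ₗ π = Φ := Finsupp.lhom_ext fun j r => by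
      rw [LinearMap.comp_apply, hπ, hΦ, hΦ, mul_smul, hb]
    exact LinearMap.congr_fun this y
  have hdec (y : B →₀ R) : ∃ (c : B →₀ K) (z : E → B →₀ R),
      π y = (c.sum fun j k => Finsupp.single j (i k * e (s j))) + ∑ a, α a • z a := by
    induction y using Finsupp.induction_linear with
    | zero => exact ⟨0, 0, by simp⟩
    | add y y' hy hy' =>
      obtain ⟨c, z, hy⟩ := hy
      obtain ⟨c', z', hy'⟩ := hy'
      refine ⟨c + c', z + z', ?_⟩
      rw [map_add, hy, hy', Finsupp.sum_add_index']
      · simp only [Pi.add_apply, smul_add, Finset.sum_add_distrib]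
        abel
      · simp
      · intro j k k'
        rw [map_add, add_mul, Finsupp.single_add]
    | single j r =>
      obtain ⟨c, z, hr⟩ := h.decomp r
      refine ⟨Finsupp.single j (c (s j)), fun a => Finsupp.single j (z a * e (s j)), ?_⟩
      rw [hπ, Finsupp.sum_single_index (by simp)]
      simp only [Finsupp.smul_single, smul_eq_mul]
      rw [← Finsupp.single_finsetSum, ← Finsupp.single_add]
      congr 1
      conv_lhs => rw [hr]
      rw [add_mul, Finset.sum_mul, Finset.sum_mul, Finset.sum_eq_single (s j)]
      · rw [mul_assoc, h.vertex_idem]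
        simp only [mul_assoc]
      · intro t _ ht
        rw [mul_assoc, h.vertex_orth t _ ht, mul_zero]
      · simp
  -- The top basis lies in the range, so the cokernel is spanned by arrow multiples and Nakayama
  -- applies.
  have hsurj : Function.Surjective Φ := by
    rw [← LinearMap.range_eq_top, ← Submodule.Quotient.subsingleton_iff]
    refine subsingleton_of_forall_eq 0 (eq_zero_of_forall_exists_sum_smul α hn fun q => ?_)
    obtain ⟨m, rfl⟩ := Submodule.mkQ_surjective _ q
    obtain ⟨c, f, rfl⟩ := hspan m
    refine ⟨fun a => (LinearMap.range Φ).mkQ (f a), ?_⟩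
    simp only [← map_smul]
    rw [map_add, ← map_sum, add_eq_right, Submodule.mkQ_apply, Submodule.Quotient.mk_eq_zero]
    exact sum_mem fun j _ => ⟨Finsupp.single j (i (c j)), hΦ _ _⟩
  let P : Submodule R (B →₀ R) := LinearMap.range π
  have hP : Module.Projective R P :=
    Module.Projective.of_split P.subtype π.rangeRestrict <| LinearMap.ext <| by
      rintro ⟨_, y, rfl⟩
      exact Subtype.ext (hππ y)
  -- Nakayama again: independence of the top basis removes the vertex part of a kernel element, and
  -- `hM` allows the arrow part to be written with coefficients in the kernel.
  have hinj : ∀ y : ↥(LinearMap.ker Φ ⊓ P), y = 0 := by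
    refine fun y => eq_zero_of_forall_exists_sum_smul (M := ↥(LinearMap.ker Φ ⊓ P)) α hn ?_ y
    rintro ⟨y, hy0, y, rfl⟩
    obtain ⟨c, z, hy⟩ := hdec y
    have hΦy : (c.sum fun j k => i k • b j) + ∑ a, α a • Φ (z a) = 0 := by
      have : Φ (π y) = 0 := hy0
      rw [hy, map_add, map_finsuppSum, map_sum] at this
      simpa only [hΦ, mul_smul, hb, map_smul] using this
    have hc : c = 0 := by
      refine hli c (fun a => - Φ (z a)) ?_
      simp only [smul_neg, Finset.sum_neg_distrib]
      exact eq_neg_of_add_eq_zero_left hΦy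
    subst hc
    rw [Finsupp.sum_zero_index, zero_add] at hΦy hy
    -- Applying `π` puts the coefficients in `P`, and the factor `e (tail a)` puts them in the
    -- kernel by `hM`. The sum is unchanged because `π` fixes it and `α a` absorbs `e (tail a)`.
    refine ⟨fun a => ⟨e (tail a) • π (z a), ?_, ?_⟩, Subtype.ext ?_⟩
    · refine LinearMap.mem_ker.mpr ?_
      rw [map_smul, hΦπ, hM _ hΦy a]
    · exact P.smul_mem _ ⟨z a, rfl⟩
    · rw [AddSubmonoidClass.coe_finsetSum]
      simp only [Submodule.coe_smul]
      rw [← hππ, hy, map_sum]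
      refine Finset.sum_congr rfl fun a _ => ?_
      rw [← mul_smul, h.arrow_tail, map_smul]
  refine Module.Projective.of_equiv
    (LinearEquiv.ofBijective (Φ.domRestrict P) ⟨?_, fun m => ?_⟩)
  · rw [injective_iff_map_eq_zero]
    rintro ⟨y, hy⟩ hy0
    have h0 : y = 0 := congrArg Subtype.val (hinj ⟨y, hy0, hy⟩)
    exact Subtype.ext h0
  · obtain ⟨y, rfl⟩ := hsurj m
    exact ⟨⟨π y, y, rfl⟩, hΦπ y⟩

end IsArrowSystem

/-! ### Path rings with finitely many paths are hereditary -/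

namespace FinQuiver

open MulOpposite

variable {E : Type v} {K : Type u} [DivisionRing K] [Fintype E] (Q : FinQuiver.{v, w} E)
  [Fintype Q.Vertex] (σ : E → RingAut K)

theorem isArrowSystem {N : ℕ}
    (hN : ∀ l : List E, N ≤ l.length → pathElt (Q.arrow σ) l = 0) :
    IsArrowSystem (Q.scalarHom σ) (Q.vert σ) (Q.arrow σ) Q.head Q.tail where
  vertex_sum := (Q.isPathFamily σ).sum_vertex
  vertex_idem := (Q.isPathFamily σ).vertex_idem
  vertex_orth := (Q.isPathFamily σ).vertex_orth
  vertex_scalar := (Q.isPathFamily σ).vertex_scalar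
  head_arrow := (Q.isPathFamily σ).head_arrow
  arrow_tail := (Q.isPathFamily σ).arrow_tail
  scalar_arrow a k := ⟨(σ a).symm k, by rw [(Q.isPathFamily σ).arrow_scalar]; simp⟩
  decomp r := by
    classical
    obtain ⟨⟨c, d⟩, rfl⟩ := (Q.isPathFamily σ).comb_surjective (Q.generates σ)
      (C := fun _ _ => True) (fun b a h => absurd trivial h) r
    rw [comb_apply]
    refine ⟨c, ?_⟩
    simp only [add_right_inj]
    refine Finset.sum_induction
      (p := fun r => ∃ z : E → PathRing Q σ, r = ∑ a, Q.arrow σ a * z a) _ ?_ ⟨0, by simp⟩ ?_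
    · rintro _ _ ⟨z, rfl⟩ ⟨z', rfl⟩
      exact ⟨z + z', by simp [mul_add, Finset.sum_add_distrib]⟩
    · rintro ⟨l, hl, hc⟩ -
      obtain ⟨a, l, rfl⟩ := List.exists_cons_of_ne_nil hl
      -- The coefficient has to pass to the right of `a`, hence the inverse automorphism.
      refine ⟨Pi.single a (Q.scalarHom σ ((σ a).symm (d ⟨a :: l, hl, hc⟩)) *
        pathElt (Q.arrow σ) l), ?_⟩
      rw [Finset.sum_eq_single a]
      · dsimp only
        rw [Pi.single_eq_same, ← mul_assoc, (Q.isPathFamily σ).arrow_scalar, pathElt_cons,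
          ← mul_assoc]
        simp
      · intro b _ hb
        rw [Pi.single_eq_of_ne hb, mul_zero]
      · simp
  nilpotent := ⟨N, fun l hl => hN l hl.ge⟩

/-- Over the opposite ring arrows are reversed, so head and tail swap and words are split at their
last arrow; the scalars then need no inverse automorphism. -/
theorem isArrowSystem_op {N : ℕ}
    (hN : ∀ l : List E, N ≤ l.length → pathElt (Q.arrow σ) l = 0) :
    IsArrowSystem (Q.scalarHom σ).op (fun s => op (Q.vert σ s)) (fun a => op (Q.arrow σ a))
      Q.tail Q.head where
  vertex_sum := by
    rw [← op_one, ← (Q.isPathFamily σ).sum_vertex]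
    exact (map_sum opAddEquiv _ _).symm
  vertex_idem s := by rw [← op_mul, (Q.isPathFamily σ).vertex_idem]
  vertex_orth s t h := by rw [← op_mul, (Q.isPathFamily σ).vertex_orth _ _ h.symm, op_zero]
  vertex_scalar s k := congrArg op ((Q.isPathFamily σ).vertex_scalar s k.unop).symm
  head_arrow a := by rw [← op_mul, (Q.isPathFamily σ).arrow_tail]
  arrow_tail a := by rw [← op_mul, (Q.isPathFamily σ).head_arrow]
  scalar_arrow a k := ⟨op (σ a k.unop), congrArg op ((Q.isPathFamily σ).arrow_scalar a k.unop)⟩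
  decomp r := by
    classical
    obtain ⟨⟨c, d⟩, hr⟩ := (Q.isPathFamily σ).comb_surjective (Q.generates σ)
      (C := fun _ _ => True) (fun b a h => absurd trivial h) r.unop
    rw [comb_apply] at hr
    refine ⟨fun s => op (c s), ?_⟩
    obtain ⟨z, hz⟩ : ∃ z : E → PathRing Q σ, (d.sum fun l k => Q.scalarHom σ k *
        pathElt (Q.arrow σ) l.1) = ∑ a, z a * Q.arrow σ a := by
      refine Finset.sum_induction
        (p := fun r => ∃ z : E → PathRing Q σ, r = ∑ a, z a * Q.arrow σ a) _ ?_ ⟨0, by simp⟩ ?_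
      · rintro _ _ ⟨z, rfl⟩ ⟨z', rfl⟩
        exact ⟨z + z', by simp [add_mul, Finset.sum_add_distrib]⟩
      · rintro ⟨l, hl, hc⟩ -
        obtain ⟨m, a, rfl⟩ := (List.eq_nil_or_concat' l).resolve_left hl
        refine ⟨Pi.single a (Q.scalarHom σ (d ⟨_, hl, hc⟩) * pathElt (Q.arrow σ) m), ?_⟩
        rw [Finset.sum_eq_single a]
        · dsimp only
          rw [Pi.single_eq_same, pathElt_append, pathElt_cons, pathElt_nil, mul_one, mul_assoc]
        · intro b _ hb
          rw [Pi.single_eq_of_ne hb, zero_mul]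
        · simp
    refine ⟨fun a => op (z a), unop_injective ?_⟩
    rw [← hr, hz, unop_add, Finset.unop_sum, Finset.unop_sum]
    congr 1
    refine Finset.sum_congr rfl fun s _ => ?_
    exact ((Q.isPathFamily σ).vertex_scalar s (c s)).symm
  nilpotent := ⟨N, fun l hl => by
    have := hN l.reverse (by simpa using hl.ge)
    rw [← op_zero, ← this, pathElt, op_list_prod]
    simp [Function.comp_def]⟩

/-- Joint injectivity of the arrows holds on the ring and is inherited by its one-sided ideals. -/
theorem isHereditaryRing {N : ℕ}
    (hN : ∀ l : List E, N ≤ l.length → pathElt (Q.arrow σ) l = 0) :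
    IsHereditaryRing (PathRing Q σ) := by
  refine ⟨fun I => (Q.isArrowSystem σ hN).projective I fun m hm a => Subtype.ext ?_,
    fun I => (Q.isArrowSystem_op σ hN).projective I fun m hm a => Subtype.ext ?_⟩
  · refine Q.vert_mul_eq_zero_of_sum_arrow_mul_eq_zero σ (fun a => (m a : PathRing Q σ)) ?_ a
    simpa using congrArg Subtype.val hm
  · refine Q.mul_vert_eq_zero_of_sum_mul_arrow_eq_zero σ (fun a => (m a : PathRing Q σ)) ?_ a
    simpa using congrArg Subtype.val hm

end FinQuiver

/-! ### Levees -/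

namespace BoundQuiver

variable {E : Type v}

/-- The path `b a` of length two is defined and is not a relation. -/
def Admissible (Q : BoundQuiver.{v, w} E) (b a : E) : Prop :=
  Q.tail b = Q.head a ∧ (b, a) ∉ Q.rel

/-- Uniqueness of inadmissible continuations excludes `d a` and `b c` for `d ≠ b`, `c ≠ a`. Then `d
c` must be a relation, since otherwise `d` would have the two admissible predecessors `a` and `c`.
-/
theorem LocallyGentle.mem_rel_iff {Q : BoundQuiver.{v, w} E} (hQ : Q.LocallyGentle) {b a : E}
    (hba : (b, a) ∈ Q.rel) {d c : E} (hd : Q.tail d = Q.tail b) (hc : Q.head c = Q.tail b) :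
    (d, c) ∈ Q.rel ↔ (d = b ↔ c = a) := by
  have hs := Q.rel_comp b a hba
  have h1 (hda : (d, a) ∈ Q.rel) : d = b :=
    hQ.left_inadmissible a ⟨Q.rel_comp d a hda, hda⟩ ⟨hs, hba⟩
  have h2 (hbc : (b, c) ∈ Q.rel) : c = a :=
    hQ.right_inadmissible b ⟨Q.rel_comp b c hbc, hbc⟩ ⟨hs, hba⟩
  by_cases hdb : d = b
  · subst hdb
    simp only [true_iff]
    exact ⟨h2, fun h => h ▸ hba⟩
  · by_cases hca : c = a
    · subst hca
      simp only [iff_true]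
      exact ⟨h1, fun h => h ▸ hba⟩
    · simp only [hdb, hca, iff_true]
      by_contra hdc
      exact hca (hQ.right_admissible d ⟨hd.trans hc.symm, hdc⟩
        ⟨hd.trans hs, fun h => hdb (h1 h)⟩)

/-! ### Heads and tails in a levee -/

section levee

variable (Q : BoundQuiver.{v, w} E) (s : Q.Vertex) (b a : E)

open Classical in
theorem levee_head (f : E) : (Q.levee s b a).head f =
    if h : Q.head f = s then (if f = a then Sum.inr false else Sum.inr true)
    else Sum.inl ⟨Q.head f, h⟩ := rfl

open Classical in
theorem levee_tail (f : E) : (Q.levee s b a).tail f =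
    if h : Q.tail f = s then (if f = b then Sum.inr true else Sum.inr false)
    else Sum.inl ⟨Q.tail f, h⟩ := rfl

theorem mem_levee_rel (p : E × E) : p ∈ (Q.levee s b a).rel ↔
    p ∈ Q.rel ∧ Q.tail p.1 ≠ s ∧ Q.head p.2 ≠ s := Iff.rfl

/-- The map from the vertices of a levee which identifies the two new vertices. -/
def leveeProj : (Q.levee s b a).Vertex → Q.Vertex :=
  Sum.elim Subtype.val fun _ => s

theorem leveeProj_head (f : E) : Q.leveeProj s b a ((Q.levee s b a).head f) = Q.head f := by
  rw [levee_head]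
  split_ifs with h1 h2
  · exact h1.symm
  · exact h1.symm
  · rfl

theorem leveeProj_tail (f : E) : Q.leveeProj s b a ((Q.levee s b a).tail f) = Q.tail f := by
  rw [levee_tail]
  split_ifs with h1 h2
  · exact h1.symm
  · exact h1.symm
  · rfl

/-- At the split vertex the condition is the negation of the one in `LocallyGentle.mem_rel_iff`:
arrows stay composable exactly when they did not form a relation. -/
theorem levee_tail_eq_head_iff (d c : E) :
    (Q.levee s b a).tail d = (Q.levee s b a).head c ↔
      (Q.tail d = s ∧ Q.head c = s ∧ (d = b ↔ c ≠ a)) ∨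
        (Q.tail d ≠ s ∧ Q.tail d = Q.head c) := by
  classical
  change (if h : Q.tail d = s then (if d = b then Sum.inr true else Sum.inr false)
    else Sum.inl ⟨Q.tail d, h⟩ : {t : Q.Vertex // t ≠ s} ⊕ Bool) =
    (if h : Q.head c = s then (if c = a then Sum.inr false else Sum.inr true)
    else Sum.inl ⟨Q.head c, h⟩) ↔ _
  by_cases h1 : Q.tail d = s
  · rw [dif_pos h1]
    by_cases h2 : Q.head c = s
    · rw [dif_pos h2]
      grind
    · rw [dif_neg h2]
      grind
  · rw [dif_neg h1]
    by_cases h2 : Q.head c = s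
    · rw [dif_pos h2]
      grind
    · rw [dif_neg h2]
      simp [h1]

end levee

/-- The admissible paths of length two do not change when a levee is taken. -/
theorem LocallyGentle.levee_admissible_iff {Q : BoundQuiver.{v, w} E} (hQ : Q.LocallyGentle)
    {b a : E} (hba : (b, a) ∈ Q.rel) (d c : E) :
    (Q.levee (Q.tail b) b a).Admissible d c ↔ Q.Admissible d c := by
  simp only [Admissible, levee_tail_eq_head_iff, mem_levee_rel]
  by_cases hd : Q.tail d = Q.tail b
  · by_cases hc : Q.head c = Q.tail b
    · have := hQ.mem_rel_iff hba hd hc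
      grind
    · grind
  · grind

/-- Identifying the new vertices gives back the old quiver, so degrees do not grow; relations only
disappear, and the admissible pairs are the same. -/
theorem LocallyGentle.levee {Q : BoundQuiver.{v, w} E} (hQ : Q.LocallyGentle)
    {b a : E} (hba : (b, a) ∈ Q.rel) : (Q.levee (Q.tail b) b a).LocallyGentle where
  head_le_two t := by
    refine (Set.encard_le_encard fun f hf => ?_).trans
      (hQ.head_le_two (Q.leveeProj (Q.tail b) b a t))
    exact (Q.leveeProj_head (Q.tail b) b a f).symm.trans (congrArg _ hf)
  tail_le_two t := by
    refine (Set.encard_le_encard fun f hf => ?_).trans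
      (hQ.tail_le_two (Q.leveeProj (Q.tail b) b a t))
    exact (Q.leveeProj_tail (Q.tail b) b a f).symm.trans (congrArg _ hf)
  left_inadmissible d := (hQ.left_inadmissible d).anti
    fun c hc => ⟨Q.rel_comp c d hc.2.1, hc.2.1⟩
  left_admissible d := (hQ.left_admissible d).anti
    fun c hc => (hQ.levee_admissible_iff hba c d).mp hc
  right_inadmissible d := (hQ.right_inadmissible d).anti
    fun c hc => ⟨Q.rel_comp d c hc.2.1, hc.2.1⟩
  right_admissible d := (hQ.right_admissible d).anti
    fun c hc => (hQ.levee_admissible_iff hba d c).mp hc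

/-- `π` exhibits the vertices of `Q` as obtained from those of `P` by identifying some pairs, in
such a way that the admissible paths of both are the same. -/
structure IsFolding (Q P : BoundQuiver.{v, w} E) (π : P.Vertex → Q.Vertex) : Prop where
  gentle : P.LocallyGentle
  surjective : Function.Surjective π
  head (a : E) : π (P.head a) = Q.head a
  tail (a : E) : π (P.tail a) = Q.tail a
  admissible_iff (b a : E) : P.Admissible b a ↔ Q.Admissible b a
  fibre (s : Q.Vertex) : ∃ t₁ t₂, ∀ t, π t = s → t = t₁ ∨ t = t₂
  fibre_rel (b a : E) : (b, a) ∈ P.rel → ∀ t, π t = π (P.tail b) → t = P.tail b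

theorem IsFolding.refl {Q : BoundQuiver.{v, w} E} (hQ : Q.LocallyGentle) : IsFolding Q Q id where
  gentle := hQ
  surjective := Function.surjective_id
  head _ := rfl
  tail _ := rfl
  admissible_iff _ _ := Iff.rfl
  fibre s := ⟨s, s, fun _ h => Or.inl h⟩
  fibre_rel _ _ _ _ h := h

/-- The invariant `fibre_rel` keeps the fibres small: a vertex that carries a relation is alone in
its fibre, so only such vertices are split, and the two new vertices carry no relation. -/
theorem IsFolding.levee {Q P : BoundQuiver.{v, w} E} {π : P.Vertex → Q.Vertex}
    (h : IsFolding Q P π) {b a : E} (hba : (b, a) ∈ P.rel) :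
    IsFolding Q (P.levee (P.tail b) b a) (π ∘ P.leveeProj (P.tail b) b a) where
  gentle := h.gentle.levee hba
  surjective := by
    refine h.surjective.comp fun t => ?_
    by_cases ht : t = P.tail b
    · exact ⟨Sum.inr true, ht.symm⟩
    · exact ⟨Sum.inl ⟨t, ht⟩, rfl⟩
  head f := by rw [Function.comp_apply, leveeProj_head, h.head]
  tail f := by rw [Function.comp_apply, leveeProj_tail, h.tail]
  admissible_iff d c := (h.gentle.levee_admissible_iff hba d c).trans (h.admissible_iff d c)
  fibre s := by
    classical
    by_cases hs : π (P.tail b) = s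
    · refine ⟨Sum.inr true, Sum.inr false, ?_⟩
      rintro (⟨t, ht⟩ | t) htp
      · exact absurd (h.fibre_rel b a hba t (htp.trans hs.symm)) ht
      · cases t
        · exact Or.inr rfl
        · exact Or.inl rfl
    · obtain ⟨t₁, t₂, ht⟩ := h.fibre s
      -- `t₁` or `t₂` might be the split vertex; any default value then serves, as that vertex is
      -- not above `s`.
      have lift (t : P.Vertex) : ∃ t' : (P.levee (P.tail b) b a).Vertex,
          ∀ h : t ≠ P.tail b, Sum.inl ⟨t, h⟩ = t' := by
        by_cases h1 : t = P.tail b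
        · exact ⟨Sum.inr true, fun h => absurd h1 h⟩
        · exact ⟨Sum.inl ⟨t, h1⟩, fun _ => rfl⟩
      obtain ⟨t₁', ht₁⟩ := lift t₁
      obtain ⟨t₂', ht₂⟩ := lift t₂
      refine ⟨t₁', t₂', ?_⟩
      rintro (⟨t, htb⟩ | t) htp
      · rcases ht t htp with rfl | rfl
        · exact Or.inl (ht₁ htb)
        · exact Or.inr (ht₂ htb)
      · exact absurd htp hs
  fibre_rel d c := by
    rintro ⟨hdc, hd, -⟩ t ht
    rw [Function.comp_apply, Function.comp_apply, leveeProj_tail] at ht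
    have ht' := h.fibre_rel d c hdc _ ht
    rw [levee_tail, dif_neg hd]
    rcases t with ⟨t, htb⟩ | t
    · exact congrArg Sum.inl (Subtype.ext ht')
    · exact absurd ht'.symm hd

theorem LocallyGentle.exists_isFolding {Q P : BoundQuiver.{v, w} E} (hQ : Q.LocallyGentle)
    (h : Relation.ReflTransGen IsLevee Q P) : ∃ π, IsFolding Q P π := by
  induction h with
  | refl => exact ⟨id, IsFolding.refl hQ⟩
  | tail _ h2 ih =>
    obtain ⟨π, hπ⟩ := ih
    obtain ⟨_, b, a, hba, rfl, -, rfl⟩ := h2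
    exact ⟨_, hπ.levee hba⟩

/-- Each levee removes at least the relation at which it is taken, so the number of relations
decreases. -/
theorem exists_isExcision [Finite E] (Q : BoundQuiver.{v, w} E) :
    ∃ Q' : FinQuiver.{v, w} E, Q.IsExcision Q' := by
  suffices h : ∀ (n : ℕ) (P : BoundQuiver.{v, w} E), P.rel.ncard ≤ n →
      ∃ P', Relation.ReflTransGen IsLevee P P' ∧ P'.rel = ∅ by
    obtain ⟨P, hP, hrel⟩ := h _ Q le_rfl
    exact ⟨P.toFinQuiver, P, hP, hrel, rfl⟩
  intro n
  induction n with
  | zero =>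
    exact fun P hP => ⟨P, .refl, (Set.ncard_eq_zero (Set.toFinite _)).mp (Nat.le_zero.mp hP)⟩
  | succ n ih =>
    intro P hP
    rcases P.rel.eq_empty_or_nonempty with hrel | ⟨⟨b, a⟩, hba⟩
    · exact ⟨P, .refl, hrel⟩
    · have hlt : (P.levee (P.tail b) b a).rel.ncard < P.rel.ncard :=
        Set.ncard_lt_ncard ⟨fun p hp => hp.1, fun hsub => (hsub hba).2.1 rfl⟩ (Set.toFinite _)
      obtain ⟨P', hP', hrel⟩ := ih (P.levee (P.tail b) b a) (by omega)
      exact ⟨P', .head ⟨_, b, a, hba, rfl, (P.rel_comp b a hba).symm, rfl⟩ hP', hrel⟩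

end BoundQuiver

/-- A quiver whose paths have bounded length is acyclic. -/
theorem FinQuiver.acyclic_of_bounded {E : Type v} (Q : FinQuiver.{v, w} E) (N : ℕ)
    (hN : ∀ l : List E, l.IsChain (fun b a => Q.tail b = Q.head a) → l.length < N) :
    Q.Acyclic := by
  intro s hs
  -- The induction prepends the last arrow of the cycle and rotates the cycle by that arrow, so the
  -- base point has to vary.
  have key (n : ℕ) : ∀ s : Q.Vertex,
      Relation.TransGen (fun s t => ∃ a : E, Q.tail a = s ∧ Q.head a = t) s s →
      ∃ l : List E, l.length = n ∧ l.IsChain (fun b a => Q.tail b = Q.head a) ∧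
        ∀ a ∈ l.head?, Q.head a = s := by
    induction n with
    | zero => exact fun s _ => ⟨[], rfl, .nil, by simp⟩
    | succ n ih =>
      intro s hs
      obtain ⟨t, hst, a, rfl, rfl⟩ := Relation.TransGen.tail'_iff.mp hs
      obtain ⟨l, hl, hc, hh⟩ := ih (Q.tail a) (Relation.TransGen.head' ⟨a, rfl, rfl⟩ hst)
      refine ⟨a :: l, by simp [hl], ?_, by simp⟩
      rw [List.isChain_cons]
      exact ⟨fun b hb => (hh b hb).symm, hc⟩
  obtain ⟨l, hl, hc, -⟩ := key N s hs
  exact absurd (hN l hc) (by omega)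

/-! ### The embedding into the path ring of an excision -/

namespace FinQuiver

variable {E : Type v} {K : Type u} [DivisionRing K]

open Classical in
/-- The defining relations of the path ring hold in `K`, with one vertex sent to `1` and all other
vertices and all arrows sent to `0`. -/
theorem isPathFamily_augmentation (Q : FinQuiver.{v, w} E) (σ : E → RingAut K) (s : Q.Vertex) :
    IsPathFamily Q σ (RingHom.id K) (fun t => if t = s then 1 else 0) (fun _ => 0) where
  vertex_sum := by
    have := Q.finite_vertex
    have := Fintype.ofFinite Q.Vertex
    rw [finsum_eq_sum_of_fintype]
    simp
  vertex_idem t := by split_ifs <;> simp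
  vertex_orth t t' h := by
    split_ifs with h1 h2
    · exact absurd (h1.trans h2.symm) h
    all_goals simp
  vertex_scalar t k := by split_ifs <;> simp
  head_arrow a := mul_zero _
  arrow_tail a := zero_mul _
  arrow_scalar a k := by simp

theorem isAugmentation (Q : FinQuiver.{v, w} E) (σ : E → RingAut K) :
    IsPathFamily.IsAugmentation Q (Q.scalarHom σ) (Q.vert σ) (Q.arrow σ)
      (fun s => (Q.isPathFamily_augmentation σ s).lift) where
  scalar _ k := IsPathFamily.lift_scalar _ k
  vertex_self s := (IsPathFamily.lift_vert _ s).trans (if_pos rfl)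
  vertex_ne _ t h := (IsPathFamily.lift_vert _ t).trans (if_neg h)
  arrow _ a := IsPathFamily.lift_arrow _ a

theorem comb_smul {V A : Type*} [Fintype V] [Ring A] (C : E → E → Prop) (i : K →+* A)
    (e : V → A) (α : E → A) (k : K) (p : (V → K) × (ChainList C →₀ K)) :
    comb C i e α (k • p) = i k * comb C i e α p := by
  obtain ⟨c, d⟩ := p
  rw [Prod.smul_mk, comb_apply, comb_apply, mul_add, Finset.mul_sum, Finsupp.mul_sum,
    Finsupp.sum_smul_index (by simp)]
  simp [mul_assoc]

/-- A `K`-ring spanned by finitely many vertices and paths is finite-dimensional. -/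
theorem finiteDimKRing_of_comb_surjective {V A : Type*} [Fintype V] [Ring A] {C : E → E → Prop}
    [Finite (ChainList C)] {i : K →+* A} {e : V → A} {α : E → A}
    (h : Function.Surjective (comb C i e α)) : FiniteDimKRing i := by
  let : Module K A := i.toModule
  let φ : (V → K) × (ChainList C →₀ K) →ₗ[K] A :=
    { toFun := comb C i e α
      map_add' := map_add _
      map_smul' := comb_smul C i e α }
  exact Module.Finite.of_surjective φ h

/-- A finite-dimensional `K`-ring contains only finitely many linearly independent paths. -/
theorem finite_chainList_of_comb_injective {V A : Type*} [Fintype V] [Ring A]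
    {C : E → E → Prop} {i : K →+* A} {e : V → A} {α : E → A}
    (h : Function.Injective (comb C i e α)) (hfin : FiniteDimKRing i) :
    Finite (ChainList C) := by
  let : Module K A := i.toModule
  have : Module.Finite K A := hfin
  refine LinearIndependent.finite (R := K) (f := fun l : ChainList C => pathElt α l.1) ?_
  rw [linearIndependent_iff]
  intro d hd
  have h0 : comb C i e α (0, d) = comb C i e α 0 := by
    rw [comb_apply, map_zero, ← hd, Finsupp.linearCombination_apply]
    simp only [Pi.zero_apply, map_zero, zero_mul, Finset.sum_const_zero, zero_add]
    rfl
  exact (Prod.ext_iff.mp (h h0)).2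

theorem exists_bound_of_finite_chainList {C : E → E → Prop} [Finite (ChainList C)] :
    ∃ N, ∀ l : List E, l.IsChain C → l.length < N := by
  obtain ⟨N, hN⟩ := (Set.finite_range fun l : ChainList C => l.1.length).bddAbove
  -- The shift makes the bound strict; the empty list is not a `ChainList` and is treated
  -- separately.
  refine ⟨N + 1, fun l hl => Nat.lt_succ_of_le ?_⟩
  by_cases h : l = []
  · simp [h]
  · exact hN ⟨⟨l, h, hl⟩, rfl⟩

end FinQuiver

namespace BoundQuiver

open FinQuiver

variable {E : Type v} {K : Type u} [DivisionRing K]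

/-! ### Generators, universal property and augmentations of the quotient -/

section quot

variable (Q : BoundQuiver.{v, w} E) (σ : E → RingAut K)

/-- The element of `K_σ Q / ⟨Z⟩` given by a trivial path. -/
noncomputable def quotVert (s : Q.Vertex) : Q.QuotRing σ :=
  (Q.relIdeal σ).ringCon.mk' (Q.toFinQuiver.vert σ s)

/-- The element of `K_σ Q / ⟨Z⟩` given by an arrow. -/
noncomputable def quotArrow (a : E) : Q.QuotRing σ :=
  (Q.relIdeal σ).ringCon.mk' (Q.toFinQuiver.arrow σ a)

theorem isPathFamily_quot :
    IsPathFamily Q.toFinQuiver σ (Q.quotScalarHom σ) (Q.quotVert σ) (Q.quotArrow σ) :=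
  (Q.toFinQuiver.isPathFamily σ).map (Q.relIdeal σ).ringCon.mk'

theorem generates_quot : Generates (Q.quotScalarHom σ) (Q.quotVert σ) (Q.quotArrow σ) :=
  (Q.toFinQuiver.generates σ).map (Q.relIdeal σ).ringCon.mk' (RingCon.mk'_surjective _)

theorem quotArrow_mul_quotArrow_of_mem {b a : E} (h : (b, a) ∈ Q.rel) :
    Q.quotArrow σ b * Q.quotArrow σ a = 0 := by
  rw [quotArrow, quotArrow, ← map_mul, ← map_zero (Q.relIdeal σ).ringCon.mk']
  exact (RingCon.eq _).mpr (TwoSidedIdeal.subset_span ⟨b, a, h, rfl⟩)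

theorem quotArrow_mul_quotArrow {b a : E} (h : ¬ Q.Admissible b a) :
    Q.quotArrow σ b * Q.quotArrow σ a = 0 := by
  by_cases hba : (b, a) ∈ Q.rel
  · exact Q.quotArrow_mul_quotArrow_of_mem σ hba
  · exact (Q.isPathFamily_quot σ).arrow_mul_arrow_eq_zero fun h' => h ⟨h', hba⟩

variable {Q σ}

/-- A homomorphism from the path ring which kills the relations factors through the quotient. -/
noncomputable def quotLift {A : Type*} [Ring A] (f : PathRing Q.toFinQuiver σ →+* A)
    (hf : ∀ b a, (b, a) ∈ Q.rel →
      f (Q.toFinQuiver.arrow σ b) * f (Q.toFinQuiver.arrow σ a) = 0) : Q.QuotRing σ →+* A :=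
  (Q.relIdeal σ).ringCon.lift f <| by
    have h : Q.relIdeal σ ≤ TwoSidedIdeal.ker f := by
      rw [relIdeal, TwoSidedIdeal.span_le]
      rintro _ ⟨b, a, hba, rfl⟩
      rw [SetLike.mem_coe, TwoSidedIdeal.mem_ker, map_mul, hf b a hba]
    exact TwoSidedIdeal.ringCon_le_iff.mp h

variable (Q σ) in
/-- The homomorphisms from `K_σ Q / ⟨Z⟩` to `K` which kill all arrows and all vertices but one. -/
noncomputable def quotAugmentation (s : Q.Vertex) : Q.QuotRing σ →+* K :=
  quotLift (Q.toFinQuiver.isPathFamily_augmentation σ s).lift fun b a _ => by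
    rw [IsPathFamily.lift_arrow, zero_mul]

variable (Q σ) in
theorem isAugmentation_quot : IsPathFamily.IsAugmentation Q.toFinQuiver (Q.quotScalarHom σ)
    (Q.quotVert σ) (Q.quotArrow σ) (Q.quotAugmentation σ) where
  scalar := (Q.toFinQuiver.isAugmentation σ).scalar
  vertex_self := (Q.toFinQuiver.isAugmentation σ).vertex_self
  vertex_ne := (Q.toFinQuiver.isAugmentation σ).vertex_ne
  arrow := (Q.toFinQuiver.isAugmentation σ).arrow

end quot

/-- `π` exhibits `P` as a quiver without relations which is obtained from `Q` by splitting some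
vertices in two, such that the paths of `P` are the nonzero paths of `Q`. -/
structure IsSplitting (Q : BoundQuiver.{v, w} E) (P : FinQuiver.{v, w} E)
    (π : P.Vertex → Q.Vertex) : Prop where
  surjective : Function.Surjective π
  head (a : E) : π (P.head a) = Q.head a
  tail (a : E) : π (P.tail a) = Q.tail a
  comp_iff (b a : E) : P.tail b = P.head a ↔ Q.Admissible b a
  fibre (s : Q.Vertex) : ∃ t₁ t₂, ∀ t, π t = s → t = t₁ ∨ t = t₂

/-- With no relation left, admissible means composable. -/
theorem LocallyGentle.exists_isSplitting {Q : BoundQuiver.{v, w} E} {P : FinQuiver.{v, w} E}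
    (hQ : Q.LocallyGentle) (hP : Q.IsExcision P) : ∃ π, IsSplitting Q P π := by
  obtain ⟨P', h, hrel, rfl⟩ := hP
  obtain ⟨π, hπ⟩ := hQ.exists_isFolding h
  refine ⟨π, hπ.surjective, hπ.head, hπ.tail, fun b a => ?_, hπ.fibre⟩
  rw [← hπ.admissible_iff, Admissible, hrel]
  simp

open Classical in
/-- The sum of the vertices above `s`. -/
noncomputable def fibreSum {V : Type*} {P : FinQuiver.{v, w} E} [Fintype P.Vertex]
    (π : P.Vertex → V) (σ : E → RingAut K) (s : V) : PathRing P σ :=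
  ∑ t, if π t = s then P.vert σ t else 0

section fibreSum

variable {V : Type*} {P : FinQuiver.{v, w} E} [Fintype P.Vertex] (π : P.Vertex → V)
  (σ : E → RingAut K)

open Classical in
theorem fibreSum_mul_vert (s : V) (t : P.Vertex) :
    fibreSum π σ s * P.vert σ t = if π t = s then P.vert σ t else 0 := by
  rw [fibreSum, Finset.sum_mul, Finset.sum_eq_single t]
  · rw [ite_mul, zero_mul, (P.isPathFamily σ).vertex_idem]
  · intro t' _ h
    rw [ite_mul, zero_mul, (P.isPathFamily σ).vertex_orth _ _ h, ite_self]
  · simp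

open Classical in
theorem vert_mul_fibreSum (s : V) (t : P.Vertex) :
    P.vert σ t * fibreSum π σ s = if π t = s then P.vert σ t else 0 := by
  rw [fibreSum, Finset.mul_sum, Finset.sum_eq_single t]
  · rw [mul_ite, mul_zero, (P.isPathFamily σ).vertex_idem]
  · intro t' _ h
    rw [mul_ite, mul_zero, (P.isPathFamily σ).vertex_orth _ _ h.symm, ite_self]
  · simp

theorem sum_scalar_mul_fibreSum [Fintype V] (c : V → K) :
    ∑ s, P.scalarHom σ (c s) * fibreSum π σ s =
      ∑ t, P.scalarHom σ (c (π t)) * P.vert σ t := by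
  classical
  simp only [fibreSum, Finset.mul_sum]
  rw [Finset.sum_comm]
  refine Finset.sum_congr rfl fun t _ => ?_
  rw [Finset.sum_eq_single (π t)]
  · rw [if_pos rfl]
  · intro s _ h
    rw [if_neg h.symm, mul_zero]
  · simp

end fibreSum

/-! ### The embedding attached to a splitting -/

namespace IsSplitting

theorem acyclic {Q : BoundQuiver.{v, w} E} {P : FinQuiver.{v, w} E}
    {π : P.Vertex → Q.Vertex} (h : IsSplitting Q P π) {N : ℕ}
    (hN : ∀ l : List E, l.IsChain Q.Admissible → l.length < N) :
    P.Acyclic :=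
  P.acyclic_of_bounded N fun l hl => hN l (hl.imp fun b a => (h.comp_iff b a).mp)

variable {Q : BoundQuiver.{v, w} E} {P : FinQuiver.{v, w} E} {π : P.Vertex → Q.Vertex}
  [Fintype P.Vertex] (h : IsSplitting Q P π) (σ : E → RingAut K)

/-- The fibres partition the vertices of `P`, so the fibre sums are again a complete family of
orthogonal idempotents. -/
theorem isPathFamily (h : IsSplitting Q P π) (σ : E → RingAut K) :
    IsPathFamily Q.toFinQuiver σ (P.scalarHom σ) (fibreSum π σ) (P.arrow σ) where
  vertex_sum := by
    have := Q.finite_vertex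
    have := Fintype.ofFinite Q.Vertex
    rw [finsum_eq_sum_of_fintype, ← (P.isPathFamily σ).sum_vertex]
    simpa using sum_scalar_mul_fibreSum π σ (fun _ => (1 : K))
  vertex_idem s := by
    classical
    conv_lhs => rw [fibreSum, Finset.sum_mul]
    rw [fibreSum]
    refine Finset.sum_congr rfl fun t _ => ?_
    split_ifs with ht
    · rw [← fibreSum, vert_mul_fibreSum, if_pos ht]
    · rw [zero_mul]
  vertex_orth s s' hs := by
    classical
    rw [fibreSum, Finset.sum_mul]
    refine Finset.sum_eq_zero fun t _ => ?_
    split_ifs with ht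
    · rw [vert_mul_fibreSum, if_neg (fun ht' => hs (ht.symm.trans ht'))]
    · rw [zero_mul]
  vertex_scalar s k := by
    classical
    rw [fibreSum, Finset.sum_mul, Finset.mul_sum]
    refine Finset.sum_congr rfl fun t _ => ?_
    split_ifs
    · exact (P.isPathFamily σ).vertex_scalar t k
    · rw [zero_mul, mul_zero]
  head_arrow a := by
    rw [← (P.isPathFamily σ).head_arrow, ← mul_assoc, fibreSum_mul_vert, if_pos (h.head a)]
  arrow_tail a := by
    rw [← (P.isPathFamily σ).arrow_tail, mul_assoc, vert_mul_fibreSum, if_pos (h.tail a)]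
  arrow_scalar := (P.isPathFamily σ).arrow_scalar

/-- The homomorphism from `K_σ Q / ⟨Z⟩` to the path ring of the split quiver. -/
noncomputable def embed : Q.QuotRing σ →+* PathRing P σ :=
  quotLift (h.isPathFamily σ).lift fun b a hba => by
    rw [IsPathFamily.lift_arrow, IsPathFamily.lift_arrow,
      (P.isPathFamily σ).arrow_mul_arrow_eq_zero fun h' => ((h.comp_iff b a).mp h').2 hba]

theorem embed_scalar (k : K) : h.embed σ (Q.quotScalarHom σ k) = P.scalarHom σ k :=
  (h.isPathFamily σ).lift_scalar k

theorem embed_vert (s : Q.Vertex) : h.embed σ (Q.quotVert σ s) = fibreSum π σ s :=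
  (h.isPathFamily σ).lift_vert s

theorem embed_arrow (a : E) : h.embed σ (Q.quotArrow σ a) = P.arrow σ a :=
  (h.isPathFamily σ).lift_arrow a

theorem embed_pathElt (l : List E) :
    h.embed σ (pathElt (Q.quotArrow σ) l) = pathElt (P.arrow σ) l := by
  simp only [map_pathElt, h.embed_arrow]

theorem embed_comp_scalarHom : (h.embed σ).comp (Q.quotScalarHom σ) = P.scalarHom σ :=
  RingHom.ext (h.embed_scalar σ)

theorem embed_comb [Fintype Q.Vertex] {C : E → E → Prop} (c : Q.Vertex → K)
    (d : ChainList C →₀ K) :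
    h.embed σ (comb C (Q.quotScalarHom σ) (Q.quotVert σ) (Q.quotArrow σ) (c, d)) =
      comb C (P.scalarHom σ) (P.vert σ) (P.arrow σ) (c ∘ π, d) := by
  rw [map_comb, h.embed_comp_scalarHom, comb_apply, comb_apply]
  simp only [h.embed_vert, h.embed_arrow, sum_scalar_mul_fibreSum, Function.comp_apply]

/-- Paths are independent in the path ring of `P`, and pullback along the surjection `π` is
injective. Independence of the admissible paths in the quotient is a by-product, with no rewriting
inside the quotient. -/
theorem embed_comb_injective [Fintype Q.Vertex] :
    Function.Injective fun p => h.embed σ (comb Q.Admissible (Q.quotScalarHom σ)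
      (Q.quotVert σ) (Q.quotArrow σ) p) := by
  rintro ⟨c, d⟩ ⟨c', d'⟩ hcd
  simp only [h.embed_comb] at hcd
  have hp := Prod.ext_iff.mp (P.comb_injective σ (fun b a => (h.comp_iff b a).mpr) hcd)
  exact Prod.ext (h.surjective.injective_comp_right hp.1) hp.2

theorem embed_injective : Function.Injective (h.embed σ) := by
  have := Q.finite_vertex
  have := Fintype.ofFinite Q.Vertex
  intro r r' hr
  obtain ⟨p, rfl⟩ := (Q.isPathFamily_quot σ).comb_surjective (Q.generates_quot σ)
    (fun _ _ => Q.quotArrow_mul_quotArrow σ) r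
  obtain ⟨p', rfl⟩ := (Q.isPathFamily_quot σ).comb_surjective (Q.generates_quot σ)
    (fun _ _ => Q.quotArrow_mul_quotArrow σ) r'
  rw [h.embed_comb_injective σ hr]

theorem finite_chainList (h : IsSplitting Q P π) (σ : E → RingAut K)
    (hfin : FiniteDimKRing (Q.quotScalarHom σ)) :
    Finite (ChainList Q.Admissible) := by
  have := Q.finite_vertex
  have := Fintype.ofFinite Q.Vertex
  exact finite_chainList_of_comb_injective (h.embed_comb_injective σ).of_comp hfin

theorem finiteDimKRing (h : IsSplitting Q P π) (σ : E → RingAut K)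
    [Finite (ChainList Q.Admissible)] : FiniteDimKRing (P.scalarHom σ) :=
  finiteDimKRing_of_comb_surjective <| (P.isPathFamily σ).comb_surjective (P.generates σ)
    (C := Q.Admissible) fun b a hba => (P.isPathFamily σ).arrow_mul_arrow_eq_zero
      fun h' => hba ((h.comp_iff b a).mp h')

theorem quot_pathElt_eq_zero {N : ℕ}
    (hN : ∀ l : List E, l.IsChain Q.Admissible → l.length < N) (l : List E) (hl : N ≤ l.length) :
    pathElt (Q.quotArrow σ) l = 0 :=
  pathElt_eq_zero_of_not_isChain (C := Q.Admissible)
    (fun _ _ hba => Q.quotArrow_mul_quotArrow σ hba) fun hc => (hN l hc).not_ge hl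

theorem pathElt_eq_zero (h : IsSplitting Q P π) (σ : E → RingAut K)
    {N : ℕ}
    (hN : ∀ l : List E, l.IsChain Q.Admissible → l.length < N) (l : List E) (hl : N ≤ l.length) :
    pathElt (P.arrow σ) l = 0 := by
  rw [← h.embed_pathElt, quot_pathElt_eq_zero σ hN l hl, map_zero]

/-- Scalars and words in the arrows correspond under the embedding. For `n = 1` this is the equality
of radicals. -/
theorem map_pathFiltration (n : ℕ) :
    (IsPathFamily.pathFiltration (Q.quotScalarHom σ) (Q.quotArrow σ) n).map
      (h.embed σ).toAddMonoidHom =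
    IsPathFamily.pathFiltration (P.scalarHom σ) (P.arrow σ) n := by
  rw [IsPathFamily.pathFiltration, IsPathFamily.pathFiltration, AddMonoidHom.map_closure]
  congr 1
  ext r
  constructor
  · rintro ⟨_, ⟨k, l, hl, rfl⟩, rfl⟩
    refine ⟨k, l, hl, ?_⟩
    change h.embed σ _ = _
    rw [map_mul, h.embed_scalar, h.embed_pathElt]
  · rintro ⟨k, l, hl, rfl⟩
    refine ⟨_, ⟨k, l, hl, rfl⟩, ?_⟩
    change h.embed σ _ = _
    rw [map_mul, h.embed_scalar, h.embed_pathElt]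

theorem image_jacobson {N : ℕ}
    (hN : ∀ l : List E, l.IsChain Q.Admissible → l.length < N) :
    h.embed σ '' (Ring.jacobson (Q.QuotRing σ) : Set (Q.QuotRing σ)) =
      (Ring.jacobson (PathRing P σ) : Set (PathRing P σ)) := by
  have h1 : (Ring.jacobson (Q.QuotRing σ) : Set (Q.QuotRing σ)) =
      IsPathFamily.pathFiltration (Q.quotScalarHom σ) (Q.quotArrow σ) 1 :=
    Set.ext <| (Q.isPathFamily_quot σ).mem_jacobson_iff (Q.generates_quot σ)
      (Q.isAugmentation_quot σ) (quot_pathElt_eq_zero σ hN)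
  have h2 : (Ring.jacobson (PathRing P σ) : Set (PathRing P σ)) =
      IsPathFamily.pathFiltration (P.scalarHom σ) (P.arrow σ) 1 :=
    Set.ext <| (P.isPathFamily σ).mem_jacobson_iff (P.generates σ)
      (P.isAugmentation σ) (h.pathElt_eq_zero σ hN)
  rw [h1, h2, ← h.map_pathFiltration]
  rfl

end IsSplitting

end BoundQuiver

/-! ### The base change of simple modules -/

section BaseChange

variable {L : Type w} {G : Type y} [Ring L] [Ring G] (f : L →+* G) {U : Type x} [AddCommGroup U]
  [Module L U]

/-- The element `g ⊗ n` of `G ⊗_L U`. -/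
def baseChangeTmul (g : G) (n : U) : BaseChange f U :=
  (balancedSubmodule f U).mkQ (g ⊗ₜ[ℤ] n)

theorem baseChangeTmul_sub_left (g g' : G) (n : U) :
    baseChangeTmul f (g - g') n = baseChangeTmul f g n - baseChangeTmul f g' n := by
  rw [baseChangeTmul, TensorProduct.sub_tmul, map_sub]; rfl

theorem baseChangeTmul_sum_left {ι : Type*} (s : Finset ι) (g : ι → G) (n : U) :
    baseChangeTmul f (∑ j ∈ s, g j) n = ∑ j ∈ s, baseChangeTmul f (g j) n := by
  rw [baseChangeTmul, TensorProduct.sum_tmul, map_sum]; rfl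

theorem baseChangeTmul_add_right (g : G) (n n' : U) :
    baseChangeTmul f g (n + n') = baseChangeTmul f g n + baseChangeTmul f g n' := by
  rw [baseChangeTmul, TensorProduct.tmul_add, map_add]; rfl

theorem baseChangeTmul_zero_left (n : U) : baseChangeTmul f 0 n = 0 := by
  rw [baseChangeTmul, TensorProduct.zero_tmul, map_zero]

theorem baseChangeTmul_zero_right (g : G) : baseChangeTmul f g (0 : U) = 0 := by
  rw [baseChangeTmul, TensorProduct.tmul_zero, map_zero]

theorem baseChangeTmul_mul (g : G) (l : L) (n : U) :
    baseChangeTmul f (g * f l) n = baseChangeTmul f g (l • n) :=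
  (Submodule.Quotient.eq _).mpr (Submodule.subset_span ⟨g, l, n, rfl⟩)

theorem baseChangeTmul_map (l : L) (n : U) :
    baseChangeTmul f (f l) n = baseChangeTmul f 1 (l • n) := by
  rw [← baseChangeTmul_mul, one_mul]

theorem smul_baseChangeTmul (g g' : G) (n : U) :
    g • baseChangeTmul f g' n = baseChangeTmul f (g * g') n := by
  rw [baseChangeTmul, ← map_smul, TensorProduct.smul_tmul', smul_eq_mul]; rfl

theorem baseChange_induction {p : BaseChange f U → Prop} (zero : p 0)
    (tmul : ∀ g n, p (baseChangeTmul f g n)) (add : ∀ a b, p a → p b → p (a + b))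
    (z : BaseChange f U) : p z := by
  obtain ⟨t, rfl⟩ := Submodule.mkQ_surjective _ z
  induction t using TensorProduct.induction_on with
  | zero => rw [map_zero]; exact zero
  | tmul g n => exact tmul g n
  | add a b ha hb => rw [map_add]; exact add _ _ ha hb

end BaseChange

/-! ### Computations modulo the paths of positive length -/

namespace FinQuiver.IsPathFamily

variable {E : Type v} {K : Type u} [DivisionRing K] {Q : FinQuiver.{v, w} E}
  {σ : E → RingAut K} {A : Type*} [Ring A] {i : K →+* A} {e : Q.Vertex → A} {α : E → A}

/-- The vertices are central modulo the paths of positive length. -/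
theorem commutator_mem_pathFiltration (h : IsPathFamily Q σ i e α)
    (hg : Generates i e α) {ε : Q.Vertex → A →+* K} (hε : IsAugmentation Q i e α ε) (r : A)
    (s : Q.Vertex) : r * e s - e s * r ∈ pathFiltration i α 1 := by
  rw [h.mem_pathFiltration_one_iff hg hε]
  intro t
  rw [map_sub, map_mul, map_mul]
  by_cases hst : s = t
  · rw [hst, hε.vertex_self, mul_one, one_mul, sub_self]
  · rw [hε.vertex_ne t s hst, mul_zero, zero_mul, sub_self]

/-- An element is, modulo the paths of positive length, a combination of vertices. -/
theorem exists_sub_sum_mem_pathFiltration [Fintype Q.Vertex] (h : IsPathFamily Q σ i e α)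
    (hg : Generates i e α) (r : A) :
    ∃ c : Q.Vertex → K, r - ∑ s, i (c s) * e s ∈ pathFiltration i α 1 := by
  obtain ⟨⟨c, d⟩, rfl⟩ := h.comb_surjective hg (C := fun _ _ => True)
    (fun b a hba => absurd trivial hba) r
  refine ⟨c, ?_⟩
  rw [comb_apply, add_sub_cancel_left]
  exact sum_mem fun l _ => AddSubgroup.subset_closure ⟨_, l.1, List.length_pos_iff.mpr l.2.1, rfl⟩

end FinQuiver.IsPathFamily

namespace BoundQuiver

open FinQuiver

variable {E : Type v} {K : Type u} [DivisionRing K]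

theorem smul_eq_zero_of_mem_pathFiltration {Q : BoundQuiver.{v, w} E} (σ : E → RingAut K) {N : ℕ}
    (hN : ∀ l : List E, l.IsChain Q.Admissible → l.length < N) {U : Type x} [AddCommGroup U]
    [Module (Q.QuotRing σ) U] [IsSimpleModule (Q.QuotRing σ) U] {r : Q.QuotRing σ}
    (hr : r ∈ IsPathFamily.pathFiltration (Q.quotScalarHom σ) (Q.quotArrow σ) 1) (n : U) :
    r • n = 0 := by
  rw [← (Q.isPathFamily_quot σ).mem_jacobson_iff (Q.generates_quot σ)
      (Q.isAugmentation_quot σ) (IsSplitting.quot_pathElt_eq_zero σ hN)] at hr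
  exact Module.mem_annihilator.mp
    (IsSemisimpleModule.jacobson_le_annihilator (Q.QuotRing σ) U hr) n

/-- Every simple module is concentrated at one vertex. -/
theorem exists_vertex_smul_eq {Q : BoundQuiver.{v, w} E} (σ : E → RingAut K) {N : ℕ}
    (hN : ∀ l : List E, l.IsChain Q.Admissible → l.length < N) (U : Type x) [AddCommGroup U]
    [Module (Q.QuotRing σ) U] [IsSimpleModule (Q.QuotRing σ) U] :
    ∃ s, ∀ n : U, Q.quotVert σ s • n = n := by
  have := Q.finite_vertex
  have := Fintype.ofFinite Q.Vertex
  have := IsSimpleModule.nontrivial (Q.QuotRing σ) U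
  obtain ⟨n, hn⟩ := exists_ne (0 : U)
  obtain ⟨s, hs⟩ : ∃ s, Q.quotVert σ s • n ≠ 0 := by
    by_contra! h0
    refine hn ?_
    rw [← one_smul (Q.QuotRing σ) n, ← (Q.isPathFamily_quot σ).sum_vertex, Finset.sum_smul]
    exact Finset.sum_eq_zero fun s _ => h0 s
  -- The fixed points of `e_s` form a submodule because `e_s` is central modulo the radical, which
  -- kills `U`. It contains the nonzero element `e_s n`, so it is all of `U`.
  let M : Submodule (Q.QuotRing σ) U :=
    { carrier := {n | Q.quotVert σ s • n = n}
      add_mem' := fun {a b} ha hb => by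
        change _ • _ = _ at ha hb
        change _ • _ = _
        rw [smul_add, ha, hb]
      zero_mem' := smul_zero _
      smul_mem' := fun r a ha => by
        change _ • _ = _ at ha
        change _ • _ = _
        have h0 := smul_eq_zero_of_mem_pathFiltration σ hN
          ((Q.isPathFamily_quot σ).commutator_mem_pathFiltration (Q.generates_quot σ)
            (Q.isAugmentation_quot σ) r s) a
        rw [sub_smul, mul_smul, mul_smul, ha, sub_eq_zero] at h0
        exact h0.symm }
  have hM : M = ⊤ := (eq_bot_or_eq_top M).resolve_left fun hbot => by
    refine hs ((Submodule.eq_bot_iff M).mp hbot _ ?_)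
    change _ • _ = _
    rw [← mul_smul, (Q.isPathFamily_quot σ).vertex_idem]
  exact ⟨s, fun n => (hM ▸ Submodule.mem_top : n ∈ M)⟩

/-! ### The length of the base change and the nodal embedding -/

namespace IsSplitting

variable {Q : BoundQuiver.{v, w} E} {P : FinQuiver.{v, w} E} {π : P.Vertex → Q.Vertex}
  [Fintype P.Vertex]

/-- Here equality of the radicals enters: `g` is the image of a radical element of the quotient,
which moves across the tensor sign and kills `n`. -/
theorem baseChangeTmul_eq_zero (h : IsSplitting Q P π) (σ : E → RingAut K) {N : ℕ}
    (hN : ∀ l : List E, l.IsChain Q.Admissible → l.length < N) {U : Type x} [AddCommGroup U]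
    [Module (Q.QuotRing σ) U] [IsSimpleModule (Q.QuotRing σ) U] {g : PathRing P σ}
    (hg : g ∈ IsPathFamily.pathFiltration (P.scalarHom σ) (P.arrow σ) 1) (n : U) :
    baseChangeTmul (h.embed σ) g n = 0 := by
  rw [← h.map_pathFiltration] at hg
  obtain ⟨r, hr, rfl⟩ := hg
  refine (baseChangeTmul_map (h.embed σ) r n).trans ?_
  rw [smul_eq_zero_of_mem_pathFiltration σ hN hr, baseChangeTmul_zero_right]

theorem baseChangeLength_le_two (h : IsSplitting Q P π) (σ : E → RingAut K) {N : ℕ}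
    (hN : ∀ l : List E, l.IsChain Q.Admissible → l.length < N) (U : Type x) [AddCommGroup U]
    [Module (Q.QuotRing σ) U] [IsSimpleModule (Q.QuotRing σ) U] :
    baseChangeLength (h.embed σ) U ≤ 2 := by
  obtain ⟨s, hs⟩ := exists_vertex_smul_eq σ hN U
  obtain ⟨t₁, t₂, ht⟩ := h.fibre s
  let : Module (Q.QuotRing σ) (BaseChange (h.embed σ) U) :=
    Module.compHom (BaseChange (h.embed σ) U) (h.embed σ)
  -- `n ↦ e_t ⊗ n` is linear because `e_t` is central modulo the radical, whose tensors vanish.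
  let ψ (t : P.Vertex) : U →ₗ[Q.QuotRing σ] BaseChange (h.embed σ) U :=
    { toFun := fun n => baseChangeTmul (h.embed σ) (P.vert σ t) n
      map_add' := baseChangeTmul_add_right _ _
      map_smul' := fun l n => by
        refine Eq.trans ?_ (smul_baseChangeTmul (h.embed σ) (h.embed σ l) (P.vert σ t) n).symm
        rw [← baseChangeTmul_mul, eq_comm, ← sub_eq_zero, ← baseChangeTmul_sub_left]
        exact h.baseChangeTmul_eq_zero σ hN ((P.isPathFamily σ).commutator_mem_pathFiltration
          (P.generates σ) (P.isAugmentation σ) _ t) n }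
  let Ψ : U × U →ₗ[Q.QuotRing σ] BaseChange (h.embed σ) U := (ψ t₁).coprod (ψ t₂)
  have hψ (t : P.Vertex) (n : U) : baseChangeTmul (h.embed σ) (P.vert σ t) n ∈
      LinearMap.range Ψ := by
    by_cases hts : π t = s
    · rcases ht t hts with rfl | rfl
      · exact ⟨(n, 0), by simp [Ψ, ψ, baseChangeTmul_zero_right]⟩
      · exact ⟨(0, n), by simp [Ψ, ψ, baseChangeTmul_zero_right]⟩
    -- Off the fibre, `e_t ⊗ n = e_t e_s ⊗ n = 0`.
    · rw [← hs n, ← baseChangeTmul_mul, h.embed_vert, vert_mul_fibreSum, if_neg hts,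
        baseChangeTmul_zero_left]
      exact zero_mem _
  have hΨ : Function.Surjective Ψ := by
    rw [← LinearMap.range_eq_top, eq_top_iff]
    rintro z -
    refine baseChange_induction (h.embed σ) (p := fun z => z ∈ LinearMap.range Ψ) (zero_mem _)
      (fun g n => ?_) (fun _ _ => add_mem) z
    -- Modulo the radical `g` is a combination of vertices, and its scalars can be moved into `U`.
    obtain ⟨c, hc⟩ := (P.isPathFamily σ).exists_sub_sum_mem_pathFiltration (P.generates σ) g
    have h0 := h.baseChangeTmul_eq_zero σ hN hc n
    rw [baseChangeTmul_sub_left, sub_eq_zero] at h0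
    rw [h0, baseChangeTmul_sum_left]
    refine sum_mem fun t _ => ?_
    rw [← (P.isPathFamily σ).vertex_scalar, ← h.embed_scalar, baseChangeTmul_mul]
    exact hψ t _
  refine (Module.length_le_of_surjective Ψ hΨ).trans ?_
  rw [Module.length_prod, Module.length_eq_one]
  exact le_of_eq one_add_one_eq_two

/-- The embedding of `K_σ Q / ⟨Z⟩` in the path ring of the split quiver is a nodal embedding. -/
theorem isNodalEmbedding [Finite E] (h : IsSplitting Q P π) (σ : E → RingAut K)
    (hfin : FiniteDimKRing (Q.quotScalarHom σ)) :
    IsNodalEmbedding.{u, max u v w, x, max u v w} (Q.quotScalarHom σ) (P.scalarHom σ)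
      (h.embed σ) := by
  have := Fintype.ofFinite E
  have := h.finite_chainList σ hfin
  obtain ⟨N, hN⟩ := exists_bound_of_finite_chainList (C := Q.Admissible)
  exact
    { finite_dim_sub := hfin
      finite_dim := h.finiteDimKRing σ
      hereditary := P.isHereditaryRing σ (h.pathElt_eq_zero σ hN)
      injective := h.embed_injective σ
      comp_eq := h.embed_comp_scalarHom σ
      radical_eq := h.image_jacobson σ hN
      length_le := fun U _ _ _ => h.baseChangeLength_le_two σ hN U }

end IsSplitting

end BoundQuiver

theorem theorem5 {K : Type u} [DivisionRing K] {E : Type v} [Finite E]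
    (Q : BoundQuiver.{v, w} E) (hQ : Q.LocallyGentle) (σ : E → RingAut K)
    (hfin : FiniteDimKRing (Q.quotScalarHom σ)) :
    IsNodal.{u, max u v w, x} (Q.quotScalarHom σ) ∧
    (∃ Q' : FinQuiver.{v, w} E, Q.IsExcision Q') ∧
    ∀ Q' : FinQuiver.{v, w} E, Q.IsExcision Q' →
      Q'.Acyclic ∧
      IsNodalConnectedWith.{u, max u v w, x, max u v w}
        (Q.quotScalarHom σ) (Q'.scalarHom σ) := by
  have key (Q' : FinQuiver.{v, w} E) (hQ' : Q.IsExcision Q') : Q'.Acyclic ∧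
      IsNodalConnectedWith.{u, max u v w, x, max u v w}
        (Q.quotScalarHom σ) (Q'.scalarHom σ) := by
    obtain ⟨π, h⟩ := hQ.exists_isSplitting hQ'
    have := Q'.finite_vertex
    have := Fintype.ofFinite Q'.Vertex
    have := h.finite_chainList σ hfin
    obtain ⟨N, hN⟩ := FinQuiver.exists_bound_of_finite_chainList (C := Q.Admissible)
    exact ⟨h.acyclic hN, h.embed σ, h.isNodalEmbedding σ hfin⟩
  -- Any excision witnesses nodality; its path ring lies in the universe of the quotient ring, as
  -- `IsNodal` requires.
  obtain ⟨Q', hQ'⟩ := Q.exists_isExcision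
  exact ⟨⟨_, inferInstance, Q'.scalarHom σ, (key Q' hQ').2⟩, ⟨Q', hQ'⟩, key⟩
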